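/- Let $G$ be an $n$-dimensional (Hausdorff, second countable, smooth) Lie group with neutral element $e$, let $m$ (written $dg$) be a right-invariant Haar measure on $G$, $L^2(G)=L^2(G,m)$ (real-valued functions) with norm $\|\cdot\|_2$, and let $X_1,\dots,X_n$ be a basis of the Lie algebra of $G$, regarded as left-invariant vector fields. Derivatives $X_if$ and $X_jX_kf=X_j(X_kf)$ of functions on $G$ are weak: for locally integrable $f,h$, $X_if=h$ means $\int_G f\,X_i\varphi\,dg=-\int_G h\,\varphi\,dg$ for all $\varphi\in C_c^\infty(G)$. Assume: 1. $b^i,a^{jk}$ ($1\le i,j,k\le n$) are bounded Borel measurable functions on $G$, and the matrix $(a^{jk}(g))$ is symmetric and non-negative definite for each $g\in G$. 2. $x^1,\dots,x^n\in C_c^\infty(G)$ are canonical coordinates, with respect to the basis $X_1,\dots,X_n$, on an open neighbourhood $U$ of $e$ with compact closure: $x^i(e)=0$ and $\tau=\exp\big(\sum_i x^i(\tau)X_i\big)$ for all $\tau\in U$. 3. $\nu$ is a Lévy kernel on $G$: each $\nu(g,\cdot)$ is a Borel measure with $\nu(g,\{g\})=0$, the map $g\mapsto\nu(g,gE)$ is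 measurable for each Borel set $E$, and $\sup_{g\in G}\int_G\big(\sum_i x^i(\tau)^2\wedge 1\big)\,\nu(g,g\,d\tau)<\infty$. 4. $\rho$ is a Lévy measure on $G$: a Borel measure with $\rho(\{e\})=0$, $\rho(V^c)<\infty$ for every neighbourhood $V$ of $e$, and $\int_G\big(\sum_i x^i(\tau)^2\wedge 1\big)\,\rho(d\tau)<\infty$. For every $g\in G$ the measure $\nu(g,g\,\cdot)$ is absolutely continuous with respect to $\rho$, with Radon–Nikodým derivative (a fixed version) $\lambda(g,\cdot):G\to[0,\infty]$. 5. $\sup_{\tau\in U^c}\sup_{g\in G}\lambda(g,\tau)<\infty$, and there is $g'\in G$ with $\lambda(g',\tau)=\sup_{g\in G}\lambda(g,\tau)$ for all $\tau\in U$. Let $\mathcal L$ be the Courrège–Hunt operator with these characteristics, $$\mathcal Lf(g)=\sum_i b^i(g)X_if(g)+\sum_{i,j}a^{ij}(g)X_iX_jf(g)+\int_G\Big[f(\tau)-f(g)-\sum_i x^i(g^{-1}\tau)X_if(g)\Big]\nu(g,d\tau),$$ a linear operator in $L^2(G)$ whose domain $\mathrm{Dom}(\mathcal L)$ consists of all $f\in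 L^2(G)$ for which the derivatives $X_if$, $X_iX_jf$ exist as locally integrable functions, the integral converges absolutely for almost every $g$, and $\mathcal Lf\in L^2(G)$. Let $$\mathcal H_2(G)=\{f\in L^2(G): X_if\in L^2(G),\ X_jX_kf\in L^2(G),\ 1\le i,j,k\le n\},$$ $$|||f|||_2=\Big(\|f\|_2^2+\sum_{i}\|X_if\|_2^2+\sum_{j,k}\|X_jX_kf\|_2^2\Big)^{1/2}.$$ Then $\mathcal H_2(G)\subseteq\mathrm{Dom}(\mathcal L)$, and there exists $C>0$ such that $\|\mathcal Lf\|_2\le C\,|||f|||_2$ for all $f\in\mathcal H_2(G)$. Hence $\mathcal L$ is a bounded linear operator from $\mathcal H_2(G)$, with the norm $|||\cdot|||_2$, to $L^2(G)$. -/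

import Mathlib

open MeasureTheory Filter Topology
open scoped Manifold ContDiff

set_option linter.unusedSectionVars false

noncomputable section

namespace CourregeHunt

variable {n : ℕ} {G : Type*} [TopologicalSpace G] [ChartedSpace (EuclideanSpace ℝ (Fin n)) G]
  [Group G] [MeasurableSpace G]

/-! ### Left-invariant vector fields and canonical coordinates -/

/-- The derivative `(X φ)(g)` of a (smooth) function `φ` along the left-invariant vector field `X`
whose value at the identity is `v`. -/
def lieDeriv (v : GroupLieAlgebra (𝓡 n) G) (φ : G → ℝ) (g : G) : ℝ :=
  mfderiv (𝓡 n) 𝓘(ℝ, ℝ) φ g (mulInvariantVectorField v g)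

/-- `IsExp v τ` says `τ = exp v`: the integral curve of the left-invariant vector field of `v` that
starts at the identity (the one-parameter subgroup `t ↦ exp (t v)`) is at `τ` at time `1`. -/
def IsExp (v : GroupLieAlgebra (𝓡 n) G) (τ : G) : Prop :=
  ∃ γ : ℝ → G, IsMIntegralCurve (I := 𝓡 n) γ (mulInvariantVectorField v) ∧ γ 0 = 1 ∧ γ 1 = τ

/-- `x₁, …, xₙ ∈ C_c^∞(G)` are canonical coordinates (of the first kind, with respect to the basis
`X` of the Lie algebra) on the relatively compact open neighbourhood `U` of the identity:
`τ = exp (∑ xᵢ(τ) Xᵢ)` for `τ ∈ U`, and the identity has coordinates `0`.  As `exp` has a smooth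
local inverse `x` on `U`, the map `x` is then a diffeomorphism of `U` onto an open set. -/
structure IsCanonicalCoord (X : Module.Basis (Fin n) ℝ (GroupLieAlgebra (𝓡 n) G))
    (U : Set G) (x : Fin n → G → ℝ) : Prop where
  isOpen : IsOpen U
  one_mem : (1 : G) ∈ U
  isCompact_closure : IsCompact (closure U)
  contMDiff : ∀ i, ContMDiff (𝓡 n) 𝓘(ℝ, ℝ) ∞ (x i)
  hasCompactSupport : ∀ i, HasCompactSupport (x i)
  map_one : ∀ i, x i 1 = 0
  isExp : ∀ τ ∈ U, IsExp (∑ i, x i τ • X i) τ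

/-! ### Characteristics of a Courrège–Hunt operator -/

/-- The truncated square `(∑ xᵢ(τ)²) ∧ 1`. -/
def truncSq (x : Fin n → G → ℝ) (τ : G) : ENNReal := ENNReal.ofReal (min (∑ i, x i τ ^ 2) 1)

/-- Lévy measures on `G`: no mass at the identity, finite mass off each neighbourhood of the
identity, and `∫ (∑ xᵢ² ∧ 1) dρ < ∞`. -/
structure IsLevyMeasure (x : Fin n → G → ℝ) (ρ : Measure G) : Prop where
  singleton_one : ρ {1} = 0
  compl_lt_top : ∀ V ∈ 𝓝 (1 : G), ρ Vᶜ < ⊤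
  lintegral_lt_top : ∫⁻ τ, truncSq x τ ∂ρ < ⊤

/-- The measure `E ↦ m(gE)`; applied to `m = ν(g, ·)` it is `ν(g, g dτ)`. -/
def leftShift (g : G) (m : Measure G) : Measure G := m.map (fun τ => g⁻¹ * τ)

/-- `ν` is a Lévy kernel. -/
structure IsLevyKernel (x : Fin n → G → ℝ) (ν : G → Measure G) : Prop where
  singleton_self : ∀ g, ν g {g} = 0
  measurable : ∀ E, MeasurableSet E → Measurable fun g => leftShift g (ν g) E
  iSup_lt_top : (⨆ g, ∫⁻ τ, truncSq x τ ∂(leftShift g (ν g))) < ⊤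

/-- Characteristics `(b, a, ν)` of a Courrège–Hunt operator, with the canonical coordinates
`x` on `U`, the reference Lévy measure `ρ` and the density `dens g τ` (usually written `λ(g, τ)`)
of `ν(g, g dτ)` with respect to `ρ(dτ)`. -/
structure Characteristics (X : Module.Basis (Fin n) ℝ (GroupLieAlgebra (𝓡 n) G)) where
  b : Fin n → G → ℝ
  a : G → Matrix (Fin n) (Fin n) ℝ
  U : Set G
  x : Fin n → G → ℝ
  ν : G → Measure G
  ρ : Measure G
  dens : G → G → ENNReal
  measurable_b : ∀ i, Measurable (b i)
  bounded_b : ∀ i, ∃ M, ∀ g, |b i g| ≤ M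
  measurable_a : ∀ i j, Measurable fun g => a g i j
  bounded_a : ∀ i j, ∃ M, ∀ g, |a g i j| ≤ M
  posSemidef_a : ∀ g, (a g).PosSemidef
  canonical : IsCanonicalCoord X U x
  kernel : IsLevyKernel x ν
  levy : IsLevyMeasure x ρ
  measurable_dens : ∀ g, Measurable (dens g)
  leftShift_eq : ∀ g, leftShift g (ν g) = ρ.withDensity (dens g)
  dens_off : (⨆ τ ∈ Uᶜ, ⨆ g, dens g τ) < ⊤
  dens_on : ∃ g', ∀ τ ∈ U, dens g' τ = ⨆ g, dens g τ

/-! ### Weak derivatives -/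

/-- `h` is the weak derivative `X f` of `f` along the left-invariant vector field `X` of `v`.
(If `μ` is a right Haar measure, then `X` has divergence zero.) -/
structure IsWeakLieDeriv (μ : Measure G) (v : GroupLieAlgebra (𝓡 n) G) (f h : G → ℝ) : Prop where
  left : LocallyIntegrable f μ
  right : LocallyIntegrable h μ
  integral_eq : ∀ φ : G → ℝ, ContMDiff (𝓡 n) 𝓘(ℝ, ℝ) ∞ φ → HasCompactSupport φ →
    ∫ g, lieDeriv v φ g * f g ∂μ = - ∫ g, φ g * h g ∂μ

/-- `X f ∈ L²(G)` for `f ∈ L²(G)`. -/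
def HasL2Deriv (μ : Measure G) (v : GroupLieAlgebra (𝓡 n) G) (f : Lp ℝ 2 μ) : Prop :=
  ∃ h : Lp ℝ 2 μ, IsWeakLieDeriv μ v f h

open Classical in
/-- The element `X f` of `L²(G)` (`0` if the weak derivative is not in `L²(G)`). -/
def l2Deriv (μ : Measure G) (v : GroupLieAlgebra (𝓡 n) G) (f : Lp ℝ 2 μ) : Lp ℝ 2 μ :=
  if h : HasL2Deriv μ v f then h.choose else 0

section helpers

variable [T2Space G] [SecondCountableTopology G] [LieGroup (𝓡 n) ∞ G] [BorelSpace G]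
  {μ : Measure G} {v : GroupLieAlgebra (𝓡 n) G} {f f' h h' : G → ℝ}

lemma continuous_lieDeriv (v : GroupLieAlgebra (𝓡 n) G) {φ : G → ℝ}
    (hφ : ContMDiff (𝓡 n) 𝓘(ℝ, ℝ) ∞ φ) : Continuous (lieDeriv v φ) := by
  have : LieGroup (𝓡 n) (minSmoothness ℝ 3) G := by
    rw [minSmoothness_of_isRCLikeNormedField]; infer_instance
  have h1 := (hφ.continuous_tangentMap (by simp)).comp
    (contMDiff_mulInvariantVectorField v).continuous
  exact (contMDiff_snd_tangentBundle_modelSpace ℝ 𝓘(ℝ, ℝ) (n := 0)).continuous.comp h1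

lemma hasCompactSupport_lieDeriv (v : GroupLieAlgebra (𝓡 n) G) {φ : G → ℝ}
    (hc : HasCompactSupport φ) : HasCompactSupport (lieDeriv v φ) := by
  refine hc.mono' fun g hg => ?_
  by_contra hg'
  apply hg
  have h0 : φ =ᶠ[𝓝 g] fun _ => (0 : ℝ) := notMem_tsupport_iff_eventuallyEq.mp hg'
  simp only [lieDeriv]
  rw [h0.mfderiv_eq, mfderiv_const]
  rfl

lemma IsWeakLieDeriv.congr (H : IsWeakLieDeriv μ v f h) (hf : f =ᵐ[μ] f') (hh : h =ᵐ[μ] h') :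
    IsWeakLieDeriv μ v f' h' := by
  refine ⟨H.left.congr hf, H.right.congr hh, fun φ h1 h2 => ?_⟩
  have e1 : ∫ g, lieDeriv v φ g * f' g ∂μ = ∫ g, lieDeriv v φ g * f g ∂μ :=
    integral_congr_ae (by filter_upwards [hf] with g hg; rw [hg])
  have e2 : ∫ g, φ g * h' g ∂μ = ∫ g, φ g * h g ∂μ :=
    integral_congr_ae (by filter_upwards [hh] with g hg; rw [hg])
  rw [e1, e2, H.integral_eq φ h1 h2]

lemma IsWeakLieDeriv.add (H : IsWeakLieDeriv μ v f h) (H' : IsWeakLieDeriv μ v f' h') :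
    IsWeakLieDeriv μ v (f + f') (h + h') := by
  refine ⟨H.left.add H'.left, H.right.add H'.right, fun φ h1 h2 => ?_⟩
  have c1 := continuous_lieDeriv v h1
  have c2 := hasCompactSupport_lieDeriv v h2
  simp only [Pi.add_apply, mul_add]
  have i1 := H.left.integrable_smul_left_of_hasCompactSupport c1 c2
  have i2 := H'.left.integrable_smul_left_of_hasCompactSupport c1 c2
  have i3 := H.right.integrable_smul_left_of_hasCompactSupport h1.continuous h2
  have i4 := H'.right.integrable_smul_left_of_hasCompactSupport h1.continuous h2
  simp only [smul_eq_mul] at i1 i2 i3 i4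
  rw [integral_add i1 i2, integral_add i3 i4, H.integral_eq φ h1 h2, H'.integral_eq φ h1 h2]
  ring

lemma IsWeakLieDeriv.smul (c : ℝ) (H : IsWeakLieDeriv μ v f h) :
    IsWeakLieDeriv μ v (c • f) (c • h) := by
  refine ⟨H.left.smul c, H.right.smul c, fun φ h1 h2 => ?_⟩
  simp only [Pi.smul_apply, smul_eq_mul, mul_left_comm _ c]
  rw [integral_const_mul, integral_const_mul, H.integral_eq φ h1 h2]
  ring

lemma isWeakLieDeriv_zero : IsWeakLieDeriv μ v (0 : G → ℝ) (0 : G → ℝ) :=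
  ⟨locallyIntegrable_zero, locallyIntegrable_zero, fun φ _ _ => by simp⟩

lemma IsWeakLieDeriv.unique (H : IsWeakLieDeriv μ v f h) (H' : IsWeakLieDeriv μ v f' h')
    (hf : f =ᵐ[μ] f') : h =ᵐ[μ] h' := by
  have := (𝓡 n).locallyCompactSpace
  have := ChartedSpace.locallyCompactSpace (EuclideanSpace ℝ (Fin n)) G
  have : IsManifold (𝓡 n) ∞ G := inferInstance
  have K := (H.congr hf EventuallyEq.rfl).add (H'.smul (-1))
  have K1 : f' + (-1 : ℝ) • f' = 0 := by ext; simp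
  have key := ae_eq_zero_of_integral_contMDiff_smul_eq_zero (𝓡 n) K.right
    (fun φ h1 h2 => by
      have := K.integral_eq φ h1 h2
      rw [K1] at this
      simpa using this)
  filter_upwards [key] with g hg
  simp at hg
  linarith

lemma HasL2Deriv.spec {f : Lp ℝ 2 μ} (H : HasL2Deriv μ v f) :
    IsWeakLieDeriv μ v f (l2Deriv μ v f) := by
  rw [l2Deriv, dif_pos H]
  exact H.choose_spec

lemma l2Deriv_eq {f h : Lp ℝ 2 μ} (H : IsWeakLieDeriv μ v f h) : l2Deriv μ v f = h :=
  Lp.ext ((HasL2Deriv.spec ⟨h, H⟩).unique H EventuallyEq.rfl)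

lemma isWeak_add {f f' h h' : Lp ℝ 2 μ} (H : IsWeakLieDeriv μ v f h)
    (H' : IsWeakLieDeriv μ v f' h') : IsWeakLieDeriv μ v (f + f' : Lp ℝ 2 μ) (h + h' : Lp ℝ 2 μ) :=
  (H.add H').congr (Lp.coeFn_add f f').symm (Lp.coeFn_add h h').symm

lemma isWeak_smul (c : ℝ) {f h : Lp ℝ 2 μ} (H : IsWeakLieDeriv μ v f h) :
    IsWeakLieDeriv μ v (c • f : Lp ℝ 2 μ) (c • h : Lp ℝ 2 μ) :=
  (H.smul c).congr (Lp.coeFn_smul c f).symm (Lp.coeFn_smul c h).symm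

lemma isWeak_zero : IsWeakLieDeriv μ v (0 : Lp ℝ 2 μ) (0 : Lp ℝ 2 μ) :=
  isWeakLieDeriv_zero.congr (Lp.coeFn_zero _ _ _).symm (Lp.coeFn_zero _ _ _).symm

lemma l2Deriv_add {f f' : Lp ℝ 2 μ} (H : HasL2Deriv μ v f) (H' : HasL2Deriv μ v f') :
    l2Deriv μ v (f + f') = l2Deriv μ v f + l2Deriv μ v f' :=
  l2Deriv_eq (isWeak_add H.spec H'.spec)

lemma l2Deriv_smul (c : ℝ) {f : Lp ℝ 2 μ} (H : HasL2Deriv μ v f) :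
    l2Deriv μ v (c • f) = c • l2Deriv μ v f :=
  l2Deriv_eq (isWeak_smul c H.spec)

lemma l2Deriv_zero : l2Deriv μ v (0 : Lp ℝ 2 μ) = 0 := l2Deriv_eq isWeak_zero

lemma HasL2Deriv.add {f f' : Lp ℝ 2 μ} (H : HasL2Deriv μ v f) (H' : HasL2Deriv μ v f') :
    HasL2Deriv μ v (f + f') := ⟨_, isWeak_add H.spec H'.spec⟩

lemma HasL2Deriv.smul (c : ℝ) {f : Lp ℝ 2 μ} (H : HasL2Deriv μ v f) :
    HasL2Deriv μ v (c • f) := ⟨_, isWeak_smul c H.spec⟩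

lemma hasL2Deriv_zero : HasL2Deriv μ v (0 : Lp ℝ 2 μ) := ⟨0, isWeak_zero⟩

end helpers

/-! ### The Sobolev space `H₂(G)` -/

section sobolev

variable [T2Space G] [SecondCountableTopology G] [LieGroup (𝓡 n) ∞ G] [BorelSpace G]

/-- `H₂(G) = {f ∈ L²(G) : Xᵢ f ∈ L²(G), Xⱼ Xₖ f ∈ L²(G)}`, as a linear subspace of `L²(G)`. -/
def sobolevH2 (X : Module.Basis (Fin n) ℝ (GroupLieAlgebra (𝓡 n) G)) (μ : Measure G) :
    Submodule ℝ (Lp ℝ 2 μ) where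
  carrier := {f | (∀ i, HasL2Deriv μ (X i) f) ∧
    ∀ j k, HasL2Deriv μ (X j) (l2Deriv μ (X k) f)}
  zero_mem' := ⟨fun _ => hasL2Deriv_zero, fun _ _ => by rw [l2Deriv_zero]; exact hasL2Deriv_zero⟩
  add_mem' := fun hf hg => ⟨fun i => (hf.1 i).add (hg.1 i), fun j k => by
    rw [l2Deriv_add (hf.1 k) (hg.1 k)]; exact (hf.2 j k).add (hg.2 j k)⟩
  smul_mem' := fun c _ hf => ⟨fun i => (hf.1 i).smul c, fun j k => by
    rw [l2Deriv_smul c (hf.1 k)]; exact (hf.2 j k).smul c⟩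

/-- The Sobolev norm `(‖f‖² + ∑ ‖Xᵢ f‖² + ∑ ‖Xⱼ Xₖ f‖²)^{1/2}`. -/
def sobolevNorm (X : Module.Basis (Fin n) ℝ (GroupLieAlgebra (𝓡 n) G)) (μ : Measure G)
    (f : Lp ℝ 2 μ) : ℝ :=
  √(‖f‖ ^ 2 + ∑ i, ‖l2Deriv μ (X i) f‖ ^ 2 +
    ∑ j, ∑ k, ‖l2Deriv μ (X j) (l2Deriv μ (X k) f)‖ ^ 2)

/-- `H₂(G)` as a type of its own, which carries the Sobolev norm instead of the norm of `L²(G)`. -/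
def SobolevSpace (X : Module.Basis (Fin n) ℝ (GroupLieAlgebra (𝓡 n) G)) (μ : Measure G) : Type _ :=
  sobolevH2 X μ

variable (X : Module.Basis (Fin n) ℝ (GroupLieAlgebra (𝓡 n) G)) (μ : Measure G)

instance : AddCommGroup (SobolevSpace X μ) := inferInstanceAs (AddCommGroup (sobolevH2 X μ))

instance : Module ℝ (SobolevSpace X μ) := inferInstanceAs (Module ℝ (sobolevH2 X μ))

/-- `f ↦ (f, Xᵢ f, Xⱼ Xₖ f)`, into a finite Hilbert sum of copies of `L²(G)`. -/
def SobolevSpace.jet :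
    SobolevSpace X μ →ₗ[ℝ] PiLp 2 (fun _ : Unit ⊕ Fin n ⊕ Fin n × Fin n => Lp ℝ 2 μ) where
  toFun f := WithLp.toLp 2 (Sum.elim (fun _ => f.1) (Sum.elim (fun i => l2Deriv μ (X i) f.1)
    (fun p => l2Deriv μ (X p.1) (l2Deriv μ (X p.2) f.1))))
  map_add' f g := by
    ext1 s
    rcases s with _ | i | ⟨j, k⟩
    · rfl
    · exact l2Deriv_add (f.2.1 i) (g.2.1 i)
    · change l2Deriv μ (X j) (l2Deriv μ (X k) (f.1 + g.1)) = _
      rw [l2Deriv_add (f.2.1 k) (g.2.1 k), l2Deriv_add (f.2.2 j k) (g.2.2 j k)]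
      rfl
  map_smul' c f := by
    ext1 s
    rcases s with _ | i | ⟨j, k⟩
    · rfl
    · exact l2Deriv_smul c (f.2.1 i)
    · change l2Deriv μ (X j) (l2Deriv μ (X k) (c • f.1)) = _
      rw [l2Deriv_smul c (f.2.1 k), l2Deriv_smul c (f.2.2 j k)]
      rfl

lemma SobolevSpace.jet_injective : Function.Injective (SobolevSpace.jet X μ) := by
  intro f g hfg
  exact Subtype.ext (congrArg (fun u => u (Sum.inl ())) hfg)

instance : NormedAddCommGroup (SobolevSpace X μ) :=
  NormedAddCommGroup.induced _ _ (SobolevSpace.jet X μ) (SobolevSpace.jet_injective X μ)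

instance : NormedSpace ℝ (SobolevSpace X μ) :=
  NormedSpace.induced ℝ (SobolevSpace X μ) _ (SobolevSpace.jet X μ)

lemma SobolevSpace.norm_eq (f : SobolevSpace X μ) : ‖f‖ = sobolevNorm X μ f.1 := by
  change ‖SobolevSpace.jet X μ f‖ = _
  rw [PiLp.norm_eq_of_L2, sobolevNorm, Fintype.sum_sum_type, Fintype.sum_sum_type,
    Fintype.sum_prod_type, ← add_assoc]
  simp [SobolevSpace.jet]

end sobolev

/-! ### The Courrège–Hunt operator -/

namespace Characteristics

variable {X : Module.Basis (Fin n) ℝ (GroupLieAlgebra (𝓡 n) G)} (S : Characteristics X)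

/-- The integrand `f(τ) - f(g) - xⁱ(g⁻¹τ) Xᵢ f(g)`, where `D i` stands for `Xᵢ f`. -/
def jump (f : G → ℝ) (D : Fin n → G → ℝ) (g τ : G) : ℝ :=
  f τ - f g - ∑ i, S.x i (g⁻¹ * τ) * D i g

/-- The value at `g` of
`bⁱ Xᵢ f + aⁱʲ Xᵢ Xⱼ f + ∫ [f(τ) - f(g) - xⁱ(g⁻¹τ) Xᵢ f(g)] ν(g, dτ)`,
where `D i` stands for `Xᵢ f` and `D2 i j` for `Xᵢ Xⱼ f`. -/
def formula (f : G → ℝ) (D : Fin n → G → ℝ) (D2 : Fin n → Fin n → G → ℝ) (g : G) : ℝ :=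
  ∑ i, S.b i g * D i g + ∑ i, ∑ j, S.a g i j * D2 i j g + ∫ τ, S.jump f D g τ ∂(S.ν g)

/-- `f ∈ Dom(L)` and `L f = h`: the weak derivatives `Xᵢ f` and `Xᵢ Xⱼ f` exist as locally
integrable functions, the integral against `ν(g, ·)` converges absolutely for almost every `g`,
and the function that the formula defines almost everywhere is the element `h` of `L²(G)`. -/
def IsValue (μ : Measure G) (f h : Lp ℝ 2 μ) : Prop :=
  ∃ (D : Fin n → G → ℝ) (D2 : Fin n → Fin n → G → ℝ),
    (∀ i, IsWeakLieDeriv μ (X i) f (D i)) ∧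
    (∀ i j, IsWeakLieDeriv μ (X i) (D j) (D2 i j)) ∧
    (∀ᵐ g ∂μ, Integrable (S.jump f D g) (S.ν g)) ∧
    ∀ᵐ g ∂μ, h g = S.formula f D D2 g

section operator

variable [T2Space G] [SecondCountableTopology G] [LieGroup (𝓡 n) ∞ G] [BorelSpace G]
  (μ : Measure G)

lemma sigmaFinite_levy : SigmaFinite S.ρ := by
  obtain ⟨V, hV⟩ := (𝓝 (1 : G)).exists_antitone_basis
  refine Measure.sigmaFinite_of_countable (S := insert {1} (Set.range fun k => (V k)ᶜ))
    ((Set.countable_range _).insert _) ?_ ?_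
  · rintro s (rfl | ⟨k, rfl⟩)
    · rw [S.levy.singleton_one]; simp
    · exact S.levy.compl_lt_top _ (hV.1.mem_of_mem trivial)
  · refine Set.eq_univ_of_forall fun g => ?_
    by_cases hg : g = 1
    · exact ⟨{1}, Set.mem_insert _ _, hg⟩
    · obtain ⟨k, -, hk⟩ := hV.1.mem_iff.mp (isOpen_ne.mem_nhds (Ne.symm hg))
      exact ⟨(V k)ᶜ, Set.mem_insert_of_mem _ ⟨k, rfl⟩, fun h => hk h rfl⟩

variable {μ} in
/-- Changing a function on a `μ`-null set does not affect its integrals against `ν(g, ·)`, for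
`μ`-almost every `g`. -/
lemma ae_ae_of_ae [IsFiniteMeasureOnCompacts μ] [μ.IsMulRightInvariant] {p : G → Prop}
    (hp : ∀ᵐ g ∂μ, p g) : ∀ᵐ g ∂μ, ∀ᵐ τ ∂(S.ν g), p τ := by
  have := (𝓡 n).locallyCompactSpace
  have := ChartedSpace.locallyCompactSpace (EuclideanSpace ℝ (Fin n)) G
  have : IsTopologicalGroup G := topologicalGroup_of_lieGroup (𝓡 n) ∞
  have := S.sigmaFinite_levy
  obtain ⟨N, hN, hNm, hN0⟩ := exists_measurable_superset_of_null (ae_iff.mp hp)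
  have hm : MeasurableSet {q : G × G | q.1 * q.2 ∈ N} := measurable_mul hNm
  have h1 : (μ.prod S.ρ) {q : G × G | q.1 * q.2 ∈ N} = 0 := by
    rw [← Measure.prod_swap, Measure.map_apply measurable_swap hm,
      Measure.measure_prod_null (measurable_swap hm)]
    refine Eventually.of_forall fun τ => ?_
    exact (measure_preimage_mul_right μ τ N).trans hN0
  rw [Measure.measure_prod_null hm] at h1
  filter_upwards [h1] with g hg
  have h2 : leftShift g (S.ν g) {τ | g * τ ∈ N} = 0 := by
    rw [S.leftShift_eq]
    exact withDensity_absolutelyContinuous _ _ hg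
  have hm' : MeasurableSet {τ | g * τ ∈ N} := measurable_const_mul g hNm
  rw [leftShift, Measure.map_apply (measurable_const_mul _) hm'] at h2
  rw [ae_iff]
  refine measure_mono_null (fun τ hτ => ?_) h2
  simpa using hN hτ

variable {μ} in
lemma ae_jump_congr [IsFiniteMeasureOnCompacts μ] [μ.IsMulRightInvariant] {f f' : G → ℝ}
    (hf : f =ᵐ[μ] f') (D : Fin n → G → ℝ) :
    ∀ᵐ g ∂μ, S.jump f D g =ᵐ[S.ν g] S.jump f' D g := by
  filter_upwards [hf, S.ae_ae_of_ae hf] with g h1 h2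
  filter_upwards [h2] with τ hτ
  simp only [jump, h1, hτ]

variable {S μ} in
lemma IsValue.add [IsFiniteMeasureOnCompacts μ] [μ.IsMulRightInvariant] {f f' h h' : Lp ℝ 2 μ}
    (H : S.IsValue μ f h) (H' : S.IsValue μ f' h') : S.IsValue μ (f + f') (h + h') := by
  obtain ⟨D, D2, a1, a2, a3, a4⟩ := H
  obtain ⟨D', D2', b1, b2, b3, b4⟩ := H'
  have e : ∀ g, S.jump (f + f' : G → ℝ) (D + D') g = S.jump f D g + S.jump f' D' g := fun g => by
    ext τ
    simp only [jump, Pi.add_apply, mul_add, Finset.sum_add_distrib]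
    ring
  have c := S.ae_jump_congr (Lp.coeFn_add f f') (D + D')
  refine ⟨D + D', D2 + D2', fun i => ?_, fun i j => (a2 i j).add (b2 i j), ?_, ?_⟩
  · exact ((a1 i).add (b1 i)).congr (Lp.coeFn_add f f').symm EventuallyEq.rfl
  · filter_upwards [a3, b3, c] with g h1 h2 h3
    rw [integrable_congr h3, e]
    exact h1.add h2
  · filter_upwards [a3, b3, a4, b4, c, Lp.coeFn_add h h'] with g h1 h2 h3 h4 h5 h6
    rw [h6, Pi.add_apply, h3, h4, formula, formula, formula, integral_congr_ae h5, e,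
      integral_add' h1 h2]
    simp only [Pi.add_apply, mul_add, Finset.sum_add_distrib]
    ring

variable {S μ} in
lemma IsValue.smul [IsFiniteMeasureOnCompacts μ] [μ.IsMulRightInvariant] (c : ℝ)
    {f h : Lp ℝ 2 μ} (H : S.IsValue μ f h) : S.IsValue μ (c • f) (c • h) := by
  obtain ⟨D, D2, a1, a2, a3, a4⟩ := H
  have e : ∀ g, S.jump (c • f : G → ℝ) (c • D) g = c • S.jump f D g := fun g => by
    ext τ
    simp only [jump, Pi.smul_apply, smul_eq_mul, mul_left_comm _ c, ← Finset.mul_sum]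
    ring
  have k := S.ae_jump_congr (Lp.coeFn_smul c f) (c • D)
  refine ⟨c • D, c • D2, fun i => ?_, fun i j => (a2 i j).smul c, ?_, ?_⟩
  · exact ((a1 i).smul c).congr (Lp.coeFn_smul c f).symm EventuallyEq.rfl
  · filter_upwards [a3, k] with g h1 h3
    rw [integrable_congr h3, e]
    exact h1.smul c
  · filter_upwards [a4, k, Lp.coeFn_smul c h] with g h3 h5 h6
    rw [h6, Pi.smul_apply, h3, formula, formula, integral_congr_ae h5, e]
    simp only [Pi.smul_apply, smul_eq_mul, mul_left_comm _ c, ← Finset.mul_sum,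
      integral_const_mul]
    ring

variable {S μ} in
lemma IsValue.zero [IsFiniteMeasureOnCompacts μ] [μ.IsMulRightInvariant] :
    S.IsValue μ 0 0 := by
  have e : ∀ g, S.jump (0 : G → ℝ) 0 g = 0 := fun g => by ext τ; simp [jump]
  have k := S.ae_jump_congr (Lp.coeFn_zero ℝ 2 μ) 0
  refine ⟨0, 0, fun i => ?_, fun i j => isWeakLieDeriv_zero, ?_, ?_⟩
  · exact isWeakLieDeriv_zero.congr (Lp.coeFn_zero _ _ _).symm EventuallyEq.rfl
  · filter_upwards [k] with g h3
    rw [integrable_congr h3, e]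
    exact integrable_zero _ _ _
  · filter_upwards [k, Lp.coeFn_zero ℝ 2 μ] with g h5 h6
    rw [h6, formula, integral_congr_ae h5, e]
    simp

variable {S μ} in
lemma IsValue.eq_zero [IsFiniteMeasureOnCompacts μ] [μ.IsMulRightInvariant] {h : Lp ℝ 2 μ}
    (H : S.IsValue μ 0 h) : h = 0 := by
  obtain ⟨D, D2, a1, a2, -, a4⟩ := H
  have z1 : ∀ i, D i =ᵐ[μ] 0 := fun i =>
    (a1 i).unique isWeakLieDeriv_zero (Lp.coeFn_zero _ _ _)
  have z2 : ∀ i j, D2 i j =ᵐ[μ] 0 := fun i j => (a2 i j).unique isWeakLieDeriv_zero (z1 j)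
  have k := S.ae_jump_congr (Lp.coeFn_zero ℝ 2 μ) D
  refine Lp.ext ?_
  filter_upwards [k, a4, Lp.coeFn_zero ℝ 2 μ, eventually_all.mpr z1,
    eventually_all.mpr fun i => eventually_all.mpr (z2 i)] with g h1 h2 h3 h4 h5
  have e : S.jump (0 : G → ℝ) D g = 0 := by ext τ; simp [jump, h4]
  rw [h2, h3, formula, integral_congr_ae h1, e]
  simp [h4, h5]

/-- The graph of the Courrège–Hunt operator in `L²(G) × L²(G)`. -/
def graph [IsFiniteMeasureOnCompacts μ] [μ.IsMulRightInvariant] :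
    Submodule ℝ (Lp ℝ 2 μ × Lp ℝ 2 μ) where
  carrier := {p | S.IsValue μ p.1 p.2}
  zero_mem' := IsValue.zero
  add_mem' := IsValue.add
  smul_mem' c _ H := IsValue.smul c H

/-- The Courrège–Hunt operator `L`, a linear operator in `L²(G)` on its maximal domain. -/
def op [IsFiniteMeasureOnCompacts μ] [μ.IsMulRightInvariant] : Lp ℝ 2 μ →ₗ.[ℝ] Lp ℝ 2 μ :=
  (S.graph μ).toLinearPMap

lemma mem_op_domain [IsFiniteMeasureOnCompacts μ] [μ.IsMulRightInvariant] {f : Lp ℝ 2 μ} :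
    f ∈ (S.op μ).domain ↔ ∃ h, S.IsValue μ f h := by
  simp [op, Submodule.toLinearPMap_domain, graph]

lemma isValue_op [IsFiniteMeasureOnCompacts μ] [μ.IsMulRightInvariant] (f : (S.op μ).domain) :
    S.IsValue μ f (S.op μ f) :=
  Submodule.mem_graph_toLinearPMap (g := S.graph μ)
    (fun p hp h0 => IsValue.eq_zero (S := S) (by rw [← h0]; exact hp)) f

end operator

end Characteristics

end CourregeHunt

end

/-! The first and second order terms multiply `L²` functions by bounded coefficients, so only the
jump integral needs work. After the shift `τ ↦ gτ` its integrand is `J(g, τ) = f(gτ) - f(g) - ∑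
xᵢ(τ) Xᵢf(g)`. The point is to bound the `L²` norm of `J(·, τ)` in `g` for each fixed `τ`, and only
then to integrate in `τ`.

For `τ ∈ U`, `τ = γ(1)` for the one-parameter subgroup `γ` of `v = ∑ xᵢ(τ) Xᵢ`, and `J(·, τ)` is a
second order Taylor remainder along `γ`. Its norm is at most `n ∑ xᵢ(τ)²` times the Sobolev norm of
`f`, since right translations preserve `μ` (`eLpNorm_taylor_le`). As `f` has only weak derivatives,
the expansion is made on test functions and transferred by duality (`abs_integral_taylor_le`,
`norm_le_of_forall_smooth`). For `τ ∉ U` the triangle inequality suffices (`eLpNorm_jump_le`). Hence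
the norm of `J(·, τ)` is bounded by a multiple of `weight τ`.

By the density assumptions all the measures `ν(g, g dτ)` lie below one measure `κ` that does not
depend on `g` and integrates the weight (`exists_dominating`). Minkowski's inequality for `κ`
(`lintegral_sq_lintegral_le`) then gives both absolute convergence for almost every `g` and the `L²`
bound (`exists_integral_part`). -/

namespace CourregeHunt

/-! ### Left-invariant vector fields and one-parameter subgroups. -/

section LieDerivative

variable {n : ℕ} {G : Type*} [TopologicalSpace G] [ChartedSpace (EuclideanSpace ℝ (Fin n)) G]
  [Group G] [LieGroup (𝓡 n) ∞ G]

lemma lieGroup_minSmoothness : LieGroup (𝓡 n) (minSmoothness ℝ 3) G := by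
  rw [minSmoothness_of_isRCLikeNormedField]; infer_instance

lemma mdifferentiable_mul_left (g : G) : MDifferentiable (𝓡 n) (𝓡 n) (fun h : G => g * h) :=
  (contMDiff_mul_left (I := 𝓡 n) (n := ∞)).mdifferentiable (by simp)

/-- Chain rule at the identity for `x ↦ (gh)x = g(hx)`. -/
lemma mfderiv_mul_left_mulInvariantVectorField (v : GroupLieAlgebra (𝓡 n) G) (g h : G) :
    mfderiv (𝓡 n) (𝓡 n) (fun x : G => g * x) h (mulInvariantVectorField v h) =
      mulInvariantVectorField v (g * h) := by
  have e : (fun x : G => g * h * x) = (fun x => g * x) ∘ (fun x => h * x) := by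
    ext x; simp [mul_assoc]
  simp only [mulInvariantVectorField]
  rw [e, mfderiv_comp (I' := 𝓡 n) _ (mdifferentiable_mul_left g _) (mdifferentiable_mul_left h _)]
  -- The chain rule differentiates at `h * 1`, whose tangent space is a different type from that at
  -- `h`; the base point is changed by substitution.
  have key : ∀ (k : G) (w : EuclideanSpace ℝ (Fin n)), k = h →
      (mfderiv (𝓡 n) (𝓡 n) (fun x : G => g * x) h w : EuclideanSpace ℝ (Fin n)) =
        mfderiv (𝓡 n) (𝓡 n) (fun x : G => g * x) k w := by
    rintro k w rfl; rfl
  exact key _ _ (mul_one h)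

lemma contMDiff_one_mulInvariantVectorField (v : GroupLieAlgebra (𝓡 n) G) :
    ContMDiff (𝓡 n) (𝓡 n).tangent 1
      (fun g : G => (mulInvariantVectorField v g : TangentBundle (𝓡 n) G)) := by
  have := lieGroup_minSmoothness (n := n) (G := G)
  refine (contMDiff_mulInvariantVectorField v).of_le ?_
  rw [minSmoothness_of_isRCLikeNormedField]
  exact one_le_two

lemma isMIntegralCurve_mul_left {v : GroupLieAlgebra (𝓡 n) G} {γ : ℝ → G}
    (hγ : IsMIntegralCurve (I := 𝓡 n) γ (mulInvariantVectorField v)) (g : G) :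
    IsMIntegralCurve (I := 𝓡 n) (fun t => g * γ t) (mulInvariantVectorField v) := by
  intro t
  have h := (mdifferentiable_mul_left g (γ t)).hasMFDerivAt.comp t (hγ t)
  refine h.congr_mfderiv (ContinuousLinearMap.ext fun c : ℝ => ?_)
  change mfderiv (𝓡 n) (𝓡 n) (fun x : G => g * x) (γ t) (c • mulInvariantVectorField v (γ t)) =
    c • mulInvariantVectorField v (g * γ t)
  rw [← mfderiv_mul_left_mulInvariantVectorField]
  exact map_smul (mfderiv (𝓡 n) (𝓡 n) (fun x : G => g * x) (γ t)) c _

/-- As functions of `t`, both sides are integral curves of the same left-invariant field and agree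
at `t = 0`, so uniqueness of integral curves applies. -/
lemma mul_eq_of_isMIntegralCurve [T2Space G] {v : GroupLieAlgebra (𝓡 n) G} {γ : ℝ → G}
    (hγ : IsMIntegralCurve (I := 𝓡 n) γ (mulInvariantVectorField v)) (h0 : γ 0 = 1) (s t : ℝ) :
    γ s * γ t = γ (s + t) := by
  have : IsManifold (𝓡 n) 1 G := IsManifold.of_le (n := ∞) (by simp)
  have h := isMIntegralCurve_Ioo_eq_of_contMDiff_boundaryless (t₀ := 0)
    (contMDiff_one_mulInvariantVectorField v) (isMIntegralCurve_mul_left hγ (γ s))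
    (hγ.comp_add s) (by simp [h0])
  have := congrFun h t
  simpa [add_comm] using this

lemma hasDerivAt_comp_isMIntegralCurve {v : GroupLieAlgebra (𝓡 n) G} {γ : ℝ → G}
    (hγ : IsMIntegralCurve (I := 𝓡 n) γ (mulInvariantVectorField v)) {φ : G → ℝ}
    (hφ : ContMDiff (𝓡 n) 𝓘(ℝ, ℝ) ∞ φ) (t : ℝ) :
    HasDerivAt (fun t => φ (γ t)) (lieDeriv v φ (γ t)) t := by
  have h := (hφ.mdifferentiable (by simp) (γ t)).hasMFDerivAt.comp t (hγ t)
  rw [hasMFDerivAt_iff_hasFDerivAt] at h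
  rw [hasDerivAt_iff_hasFDerivAt]
  refine h.congr_fderiv (ContinuousLinearMap.ext fun c : ℝ => ?_)
  exact map_smul (mfderiv (𝓡 n) 𝓘(ℝ, ℝ) φ (γ t)) c _

/-- The field is the tangent map of multiplication applied to the zero vector at `g` and `v` at the
identity, a composite of smooth maps. Full smoothness is what makes derivatives of test functions
test functions again. -/
lemma contMDiff_top_mulInvariantVectorField (v : GroupLieAlgebra (𝓡 n) G) :
    ContMDiff (𝓡 n) (𝓡 n).tangent ∞
      (fun g : G => (mulInvariantVectorField v g : TangentBundle (𝓡 n) G)) := by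
  let fg : G → TangentBundle (𝓡 n) G :=
    fun g => Bundle.TotalSpace.mk' (EuclideanSpace ℝ (Fin n)) g 0
  have sfg : ContMDiff (𝓡 n) (𝓡 n).tangent ∞ fg := Bundle.contMDiff_zeroSection _ _
  let fv : G → TangentBundle (𝓡 n) G :=
    fun _ => Bundle.TotalSpace.mk' (EuclideanSpace ℝ (Fin n)) 1 v
  have sfv : ContMDiff (𝓡 n) (𝓡 n).tangent ∞ fv := contMDiff_const
  have sm : ContMDiff ((𝓡 n).prod (𝓡 n)).tangent (𝓡 n).tangent ∞
      (tangentMap ((𝓡 n).prod (𝓡 n)) (𝓡 n) (fun p : G × G => p.1 * p.2)) :=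
    ContMDiff.contMDiff_tangentMap (contMDiff_mul (𝓡 n) ∞) (by simp)
  have S := (sm.comp (contMDiff_equivTangentBundleProd_symm (I := 𝓡 n) (M := G) (I' := 𝓡 n)
    (M' := G) (n := ∞))).comp (sfg.prodMk sfv)
  have key : ∀ (k g : G) (w : EuclideanSpace ℝ (Fin n)), k = g →
      (⟨g, w⟩ : TangentBundle (𝓡 n) G) = ⟨k, w⟩ := by
    rintro k g w rfl; rfl
  refine S.congr fun g => ?_
  simp only [Function.comp_apply, tangentMap, fg, fv]
  rw [mfderiv_prod_eq_add_apply ((contMDiff_mul (𝓡 n) ∞).mdifferentiableAt (by simp))]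
  refine (key (g * 1) g _ (mul_one g)).trans ?_
  congr 1
  change (mulInvariantVectorField v g : EuclideanSpace ℝ (Fin n)) =
    (mfderiv (𝓡 n) (𝓡 n) (fun z : G => z * 1) g 0 : EuclideanSpace ℝ (Fin n)) +
      (mfderiv (𝓡 n) (𝓡 n) (fun z : G => g * z) 1 v : EuclideanSpace ℝ (Fin n))
  have h0 : (mfderiv (𝓡 n) (𝓡 n) (fun z : G => z * 1) g 0 : EuclideanSpace ℝ (Fin n)) = 0 :=
    map_zero (mfderiv (𝓡 n) (𝓡 n) (fun z : G => z * 1) g)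
  rw [h0, zero_add]
  rfl

lemma contMDiff_lieDeriv (v : GroupLieAlgebra (𝓡 n) G) {φ : G → ℝ}
    (hφ : ContMDiff (𝓡 n) 𝓘(ℝ, ℝ) ∞ φ) : ContMDiff (𝓡 n) 𝓘(ℝ, ℝ) ∞ (lieDeriv v φ) := by
  have h1 := (hφ.contMDiff_tangentMap (m := ∞) (by simp)).comp
    (contMDiff_top_mulInvariantVectorField v)
  exact (contMDiff_snd_tangentBundle_modelSpace ℝ 𝓘(ℝ, ℝ)).comp h1

lemma lieDeriv_sum {ι : Type*} (s : Finset ι) (c : ι → ℝ) (X : ι → GroupLieAlgebra (𝓡 n) G)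
    (φ : G → ℝ) (g : G) :
    lieDeriv (∑ i ∈ s, c i • X i) φ g = ∑ i ∈ s, c i * lieDeriv (X i) φ g := by
  let L : GroupLieAlgebra (𝓡 n) G →ₗ[ℝ] ℝ :=
    { toFun := fun v => lieDeriv v φ g
      map_add' := fun v w => by
        simp only [lieDeriv, mulInvariantVectorField_add]
        exact map_add (mfderiv (𝓡 n) 𝓘(ℝ, ℝ) φ g) _ _
      map_smul' := fun c v => by
        simp only [lieDeriv, mulInvariantVectorField_smul]
        exact map_smul (mfderiv (𝓡 n) 𝓘(ℝ, ℝ) φ g) _ _ }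
  exact (map_sum L _ _).trans (Finset.sum_congr rfl fun i _ => map_smul L _ _)

/-- Both sides are the derivative at `s = 0` of `φ(g γ(s) γ(t)) = φ(g γ(s + t))`. A left-invariant
field need not commute with right translations in general, but it does with those by its own
one-parameter subgroup. -/
lemma lieDeriv_comp_mul_right [T2Space G] {v : GroupLieAlgebra (𝓡 n) G} {γ : ℝ → G}
    (hγ : IsMIntegralCurve (I := 𝓡 n) γ (mulInvariantVectorField v)) (h0 : γ 0 = 1) {φ : G → ℝ}
    (hφ : ContMDiff (𝓡 n) 𝓘(ℝ, ℝ) ∞ φ) (t : ℝ) (g : G) :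
    lieDeriv v (fun g => φ (g * γ t)) g = lieDeriv v φ (g * γ t) := by
  have hψ : ContMDiff (𝓡 n) 𝓘(ℝ, ℝ) ∞ fun g => φ (g * γ t) := hφ.comp contMDiff_mul_right
  have h1 := hasDerivAt_comp_isMIntegralCurve (isMIntegralCurve_mul_left hγ g) hψ 0
  have h2 := hasDerivAt_comp_isMIntegralCurve
    ((isMIntegralCurve_mul_left hγ g).comp_add t) hφ 0
  simp only [mul_assoc, mul_eq_of_isMIntegralCurve hγ h0, h0, mul_one, Function.comp,
    zero_add] at h1 h2
  exact h1.unique h2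

/-- The constant curve is an integral curve of the zero field, hence the only one through the
identity. -/
lemma IsExp.eq_one_of_zero [T2Space G] {τ : G} (h : IsExp (0 : GroupLieAlgebra (𝓡 n) G) τ) :
    τ = 1 := by
  have : IsManifold (𝓡 n) 1 G := IsManifold.of_le (n := ∞) (by simp)
  obtain ⟨γ, hγ, h0, h1⟩ := h
  have hc : IsMIntegralCurve (I := 𝓡 n) (fun _ : ℝ => (1 : G))
      (mulInvariantVectorField (0 : GroupLieAlgebra (𝓡 n) G)) := by
    intro t
    refine (hasMFDerivAt_const (I := 𝓘(ℝ, ℝ)) (I' := 𝓡 n) (1 : G) t).congr_mfderiv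
      (ContinuousLinearMap.ext fun c : ℝ => ?_)
    have h0 : mulInvariantVectorField (0 : GroupLieAlgebra (𝓡 n) G) (1 : G) = 0 :=
      map_zero (mfderiv (𝓡 n) (𝓡 n) (fun x : G => 1 * x) 1)
    change 0 = c • mulInvariantVectorField (0 : GroupLieAlgebra (𝓡 n) G) (1 : G)
    rw [h0]
    exact (smul_zero c).symm
  have := isMIntegralCurve_Ioo_eq_of_contMDiff_boundaryless (t₀ := 0)
    (contMDiff_one_mulInvariantVectorField 0) hγ hc h0
  rw [← h1, this]

end LieDerivative

/-! ### Duality with test functions and weak second derivatives. -/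

section WeakTaylor

variable {n : ℕ} {G : Type*} [TopologicalSpace G] [ChartedSpace (EuclideanSpace ℝ (Fin n)) G]
  [Group G] [MeasurableSpace G]

lemma abs_integral_mul_le {α : Type*} [MeasurableSpace α] {μ : Measure α} {ψ : α → ℝ}
    (hψ : MemLp ψ 2 μ) (h : Lp ℝ 2 μ) :
    |∫ g, ψ g * h g ∂μ| ≤ (eLpNorm ψ 2 μ).toReal * ‖h‖ := by
  have h1 : ∫ g, ψ g * h g ∂μ = inner ℝ h (hψ.toLp ψ) := by
    rw [L2.inner_def]
    refine integral_congr_ae ?_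
    filter_upwards [hψ.coeFn_toLp] with g hg
    rw [hg]
    simp
  rw [h1, mul_comm, ← Lp.norm_toLp ψ hψ]
  exact abs_real_inner_le_norm _ _

variable [T2Space G] [SecondCountableTopology G] [LieGroup (𝓡 n) ∞ G] [BorelSpace G]
  {μ : Measure G}

include n in
lemma locallyCompactSpace_of_lieGroup : LocallyCompactSpace G := by
  have := (𝓡 n).locallyCompactSpace
  exact ChartedSpace.locallyCompactSpace (EuclideanSpace ℝ (Fin n)) G

variable (n μ) in
/-- The classes in `L²` of the smooth functions with compact support. -/
def smoothCompactSupp : Submodule ℝ (Lp ℝ 2 μ) where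
  carrier := {u | ∃ φ : G → ℝ, ContMDiff (𝓡 n) 𝓘(ℝ, ℝ) ∞ φ ∧ HasCompactSupport φ ∧ u =ᵐ[μ] φ}
  zero_mem' := ⟨0, contMDiff_const, HasCompactSupport.zero, Lp.coeFn_zero _ _ _⟩
  add_mem' := by
    rintro u w ⟨φ, h1, h2, h3⟩ ⟨ψ, k1, k2, k3⟩
    exact ⟨φ + ψ, h1.add k1, h2.add k2, (Lp.coeFn_add u w).trans (h3.add k3)⟩
  smul_mem' := by
    rintro c u ⟨φ, h1, h2, h3⟩
    exact ⟨c • φ, ((contDiff_const_smul (𝕜 := ℝ) (n := ∞) c).contMDiff).comp h1,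
      h2.smul_left (f := fun _ => c), (Lp.coeFn_smul c u).trans (h3.const_smul c)⟩

variable [IsFiniteMeasureOnCompacts μ]

lemma memLp_of_smooth {φ : G → ℝ} (h1 : ContMDiff (𝓡 n) 𝓘(ℝ, ℝ) ∞ φ)
    (h2 : HasCompactSupport φ) : MemLp φ 2 μ :=
  h1.continuous.memLp_of_hasCompactSupport h2

variable (n μ) in
-- The orthogonal complement is trivial by the fundamental lemma of the calculus of variations.
lemma dense_smoothCompactSupp : Dense (smoothCompactSupp n μ : Set (Lp ℝ 2 μ)) := by
  have := locallyCompactSpace_of_lieGroup (n := n) (G := G)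
  rw [Submodule.dense_iff_topologicalClosure_eq_top, Submodule.topologicalClosure_eq_top_iff,
    Submodule.eq_bot_iff]
  intro h hh
  have hloc : LocallyIntegrable h μ := (Lp.memLp h).locallyIntegrable (by norm_num)
  have h0 : h =ᵐ[μ] 0 := ae_eq_zero_of_integral_contMDiff_smul_eq_zero (𝓡 n) hloc
    fun φ h1 h2 => ?_
  · exact Lp.ext (h0.trans (Lp.coeFn_zero _ _ _).symm)
  have hφ := memLp_of_smooth (μ := μ) h1 h2
  have := (Submodule.mem_orthogonal _ h).mp hh (hφ.toLp φ) ⟨φ, h1, h2, hφ.coeFn_toLp⟩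
  rw [L2.inner_def] at this
  rw [← this]
  refine integral_congr_ae ?_
  filter_upwards [hφ.coeFn_toLp] with g hg
  rw [hg]
  simp [mul_comm]

/-- By density the estimate extends to all of `L²`, and it is then applied to `h` itself. -/
lemma norm_le_of_forall_smooth {h : Lp ℝ 2 μ} {K : ℝ}
    (H : ∀ φ : G → ℝ, ContMDiff (𝓡 n) 𝓘(ℝ, ℝ) ∞ φ → HasCompactSupport φ →
      |∫ g, φ g * h g ∂μ| ≤ K * (eLpNorm φ 2 μ).toReal) (hK : 0 ≤ K) : ‖h‖ ≤ K := by
  have key : ∀ u : Lp ℝ 2 μ, |inner ℝ h u| ≤ K * ‖u‖ := by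
    refine (dense_smoothCompactSupp n μ).induction ?_ ?_
    · rintro u ⟨φ, h1, h2, h3⟩
      have e : inner ℝ h u = ∫ g, φ g * h g ∂μ := by
        rw [L2.inner_def]
        refine integral_congr_ae ?_
        filter_upwards [h3] with g hg
        rw [hg]
        simp
      rw [e, Lp.norm_def, eLpNorm_congr_ae h3]
      exact H φ h1 h2
    · exact isClosed_le (by fun_prop) (by fun_prop)
  have h1 := key h
  rw [real_inner_self_eq_norm_sq, abs_of_nonneg (by positivity)] at h1
  rcases (norm_nonneg h).eq_or_lt with h0 | h0
  · rw [← h0]; exact hK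
  · nlinarith

lemma integral_lieDeriv_sum_mul {ι : Type*} (s : Finset ι) (c : ι → ℝ)
    {X : ι → GroupLieAlgebra (𝓡 n) G} {f : Lp ℝ 2 μ} {D : ι → Lp ℝ 2 μ}
    (hD : ∀ i, IsWeakLieDeriv μ (X i) f (D i)) {φ : G → ℝ}
    (h1 : ContMDiff (𝓡 n) 𝓘(ℝ, ℝ) ∞ φ) (h2 : HasCompactSupport φ) :
    ∫ g, lieDeriv (∑ i ∈ s, c i • X i) φ g * f g ∂μ = - ∑ i ∈ s, c i * ∫ g, φ g * D i g ∂μ := by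
  have e : ∀ g, lieDeriv (∑ i ∈ s, c i • X i) φ g * f g =
      ∑ i ∈ s, c i * (lieDeriv (X i) φ g * f g) := fun g => by
    rw [lieDeriv_sum, Finset.sum_mul]
    exact Finset.sum_congr rfl fun i _ => mul_assoc _ _ _
  simp_rw [e]
  rw [integral_finsetSum, ← Finset.sum_neg_distrib]
  · refine Finset.sum_congr rfl fun i _ => ?_
    rw [integral_const_mul, (hD i).integral_eq φ h1 h2]
    ring
  · intro i _
    have := (hD i).left.integrable_smul_left_of_hasCompactSupport
      (continuous_lieDeriv (X i) h1) (hasCompactSupport_lieDeriv (X i) h2)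
    exact this.const_mul (c i)

variable {X : Module.Basis (Fin n) ℝ (GroupLieAlgebra (𝓡 n) G)}

lemma sobolevNorm_nonneg (f : Lp ℝ 2 μ) : 0 ≤ sobolevNorm X μ f := Real.sqrt_nonneg _

lemma norm_le_sobolevNorm (f : Lp ℝ 2 μ) : ‖f‖ ≤ sobolevNorm X μ f := by
  refine Real.le_sqrt_of_sq_le ?_
  rw [add_assoc]
  refine le_add_of_nonneg_right (add_nonneg ?_ ?_)
  · exact Finset.sum_nonneg fun _ _ => sq_nonneg _
  · exact Finset.sum_nonneg fun _ _ => Finset.sum_nonneg fun _ _ => sq_nonneg _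

lemma norm_l2Deriv_le_sobolevNorm (f : Lp ℝ 2 μ) (i : Fin n) :
    ‖l2Deriv μ (X i) f‖ ≤ sobolevNorm X μ f := by
  refine Real.le_sqrt_of_sq_le (le_add_of_le_of_nonneg (le_add_of_nonneg_of_le (sq_nonneg _) ?_) ?_)
  · exact Finset.single_le_sum (f := fun i => ‖l2Deriv μ (X i) f‖ ^ 2) (fun _ _ => sq_nonneg _)
      (Finset.mem_univ i)
  · exact Finset.sum_nonneg fun _ _ => Finset.sum_nonneg fun _ _ => sq_nonneg _

lemma norm_l2Deriv_l2Deriv_le_sobolevNorm (f : Lp ℝ 2 μ) (j k : Fin n) :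
    ‖l2Deriv μ (X j) (l2Deriv μ (X k) f)‖ ≤ sobolevNorm X μ f := by
  refine Real.le_sqrt_of_sq_le (le_add_of_nonneg_of_le (add_nonneg (sq_nonneg _) ?_) ?_)
  · exact Finset.sum_nonneg fun _ _ => sq_nonneg _
  · refine (Finset.single_le_sum (f := fun k => ‖l2Deriv μ (X j) (l2Deriv μ (X k) f)‖ ^ 2)
      (fun _ _ => sq_nonneg _) (Finset.mem_univ k)).trans ?_
    exact Finset.single_le_sum
      (f := fun j => ∑ k, ‖l2Deriv μ (X j) (l2Deriv μ (X k) f)‖ ^ 2)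
      (fun _ _ => Finset.sum_nonneg fun _ _ => sq_nonneg _) (Finset.mem_univ j)

/-- The weak second derivative of `f ∈ H₂(G)` along `∑ cᵢ Xᵢ` is bounded in `L²(G)`. -/
lemma abs_integral_lieDeriv_lieDeriv_mul_le {f : Lp ℝ 2 μ} (hf : f ∈ sobolevH2 X μ)
    (c : Fin n → ℝ) {φ : G → ℝ} (h1 : ContMDiff (𝓡 n) 𝓘(ℝ, ℝ) ∞ φ) (h2 : HasCompactSupport φ) :
    |∫ g, lieDeriv (∑ i, c i • X i) (lieDeriv (∑ i, c i • X i) φ) g * f g ∂μ| ≤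
      n * (∑ i, c i ^ 2) * sobolevNorm X μ f * (eLpNorm φ 2 μ).toReal := by
  set N := sobolevNorm X μ f
  set P := (eLpNorm φ 2 μ).toReal
  have hP : 0 ≤ P := ENNReal.toReal_nonneg
  have hφ := memLp_of_smooth (μ := μ) h1 h2
  -- Two integrations by parts. The outer derivative moves to `f` first, which is why `X k` acts
  -- after `X j`; the two signs cancel.
  have e : ∫ g, lieDeriv (∑ i, c i • X i) (lieDeriv (∑ i, c i • X i) φ) g * f g ∂μ =
      ∑ j, ∑ k, c j * (c k * ∫ g, φ g * l2Deriv μ (X k) (l2Deriv μ (X j) f) g ∂μ) := by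
    rw [integral_lieDeriv_sum_mul _ c (fun i => (hf.1 i).spec) (contMDiff_lieDeriv _ h1)
      (hasCompactSupport_lieDeriv _ h2), ← Finset.sum_neg_distrib]
    refine Finset.sum_congr rfl fun j _ => ?_
    rw [integral_lieDeriv_sum_mul _ c (fun k => (hf.2 k j).spec) h1 h2, ← Finset.mul_sum]
    ring
  calc _ = |∑ j, ∑ k, c j * (c k * ∫ g, φ g * l2Deriv μ (X k) (l2Deriv μ (X j) f) g ∂μ)| := by
        rw [e]
    _ ≤ ∑ j, ∑ k, |c j| * |c k| * (P * N) := by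
        refine (Finset.abs_sum_le_sum_abs _ _).trans (Finset.sum_le_sum fun j _ => ?_)
        refine (Finset.abs_sum_le_sum_abs _ _).trans (Finset.sum_le_sum fun k _ => ?_)
        rw [abs_mul, abs_mul, ← mul_assoc]
        gcongr
        refine (abs_integral_mul_le hφ _).trans ?_
        gcongr
        exact norm_l2Deriv_l2Deriv_le_sobolevNorm f k j
    _ = (∑ j, |c j|) ^ 2 * (P * N) := by
        rw [sq, Finset.sum_mul_sum, Finset.sum_mul]
        exact Finset.sum_congr rfl fun j _ => (Finset.sum_mul _ _ _).symm
    -- Cauchy–Schwarz for a sum of `n` terms.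
    _ ≤ n * (∑ i, c i ^ 2) * (P * N) := by
        have hN : 0 ≤ N := sobolevNorm_nonneg f
        gcongr
        have := sq_sum_le_card_mul_sum_sq (s := Finset.univ) (f := fun j => |c j|)
        simpa using this
    _ = _ := by ring

end WeakTaylor

/-! ### Taylor estimates in `L²` for right translations. -/

section WeakTaylorTranslate

variable {n : ℕ} {G : Type*} [TopologicalSpace G] [ChartedSpace (EuclideanSpace ℝ (Fin n)) G]
  [Group G] [MeasurableSpace G]
  [T2Space G] [SecondCountableTopology G] [LieGroup (𝓡 n) ∞ G] [BorelSpace G]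
  {μ : Measure G}

/-- Second order Taylor expansion of a smooth function along a one-parameter subgroup. -/
lemma taylor_along_isMIntegralCurve {v : GroupLieAlgebra (𝓡 n) G} {γ : ℝ → G}
    (hγ : IsMIntegralCurve (I := 𝓡 n) γ (mulInvariantVectorField v)) (h0 : γ 0 = 1) {φ : G → ℝ}
    (hφ : ContMDiff (𝓡 n) 𝓘(ℝ, ℝ) ∞ φ) (g : G) :
    φ (g * γ (-1)) - φ g + lieDeriv v φ g =
      ∫ t in (0 : ℝ)..1, (1 - t) * lieDeriv v (lieDeriv v φ) (g * γ (-t)) := by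
  have : IsTopologicalGroup G := topologicalGroup_of_lieGroup (𝓡 n) ∞
  have hv := contMDiff_lieDeriv v hφ
  have d : ∀ {ψ : G → ℝ}, ContMDiff (𝓡 n) 𝓘(ℝ, ℝ) ∞ ψ → ∀ t : ℝ,
      HasDerivAt (fun t => ψ (g * γ (-t))) (-lieDeriv v ψ (g * γ (-t))) t := fun hψ t => by
    refine ((hasDerivAt_comp_isMIntegralCurve (isMIntegralCurve_mul_left hγ g) hψ (-t)).scomp t
      (hasDerivAt_neg t)).congr_deriv ?_
    simp
  -- An explicit antiderivative of the remainder: the first derivatives of `φ` cancel.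
  have D : ∀ t : ℝ, HasDerivAt (fun t => φ (g * γ (-t)) - (1 - t) * lieDeriv v φ (g * γ (-t)))
      ((1 - t) * lieDeriv v (lieDeriv v φ) (g * γ (-t))) t := fun t => by
    have h1 : HasDerivAt (fun t : ℝ => 1 - t) (-1) t := by
      simpa using (hasDerivAt_id t).const_sub 1
    refine ((d hφ t).sub (h1.mul (d hv t))).congr_deriv ?_
    ring
  rw [intervalIntegral.integral_eq_sub_of_hasDerivAt (fun t _ => D t)]
  · simp only [sub_self, zero_mul, sub_zero, neg_zero, h0, mul_one, one_mul]
    ring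
  · refine Continuous.intervalIntegrable ?_ _ _
    have h1 := continuous_lieDeriv v hv
    have h2 := hγ.continuous
    fun_prop

variable [IsFiniteMeasureOnCompacts μ] [μ.IsMulRightInvariant]
  {X : Module.Basis (Fin n) ℝ (GroupLieAlgebra (𝓡 n) G)}

include n in
lemma eLpNorm_comp_mul_right {φ : G → ℝ} (hφ : AEStronglyMeasurable φ μ) (σ : G) :
    eLpNorm (fun g => φ (g * σ)) 2 μ = eLpNorm φ 2 μ := by
  have : IsTopologicalGroup G := topologicalGroup_of_lieGroup (𝓡 n) ∞
  exact eLpNorm_comp_measurePreserving hφ (measurePreserving_mul_right μ σ)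

/-- The weak second order Taylor estimate, tested against a smooth function. -/
lemma abs_integral_taylor_le {f : Lp ℝ 2 μ} (hf : f ∈ sobolevH2 X μ)
    (c : Fin n → ℝ) {γ : ℝ → G}
    (hγ : IsMIntegralCurve (I := 𝓡 n) γ (mulInvariantVectorField (∑ i, c i • X i)))
    (h0 : γ 0 = 1) {φ : G → ℝ} (h1 : ContMDiff (𝓡 n) 𝓘(ℝ, ℝ) ∞ φ) (h2 : HasCompactSupport φ) :
    |∫ g, (φ (g * γ (-1)) - φ g + lieDeriv (∑ i, c i • X i) φ g) * f g ∂μ| ≤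
      n * (∑ i, c i ^ 2) * sobolevNorm X μ f * (eLpNorm φ 2 μ).toReal := by
  have : IsTopologicalGroup G := topologicalGroup_of_lieGroup (𝓡 n) ∞
  have := locallyCompactSpace_of_lieGroup (n := n) (G := G)
  set v := ∑ i, c i • X i with hv
  set W := lieDeriv v (lieDeriv v φ) with hW
  set K := n * (∑ i, c i ^ 2) * sobolevNorm X μ f * (eLpNorm φ 2 μ).toReal
  have hWs : ContMDiff (𝓡 n) 𝓘(ℝ, ℝ) ∞ W := contMDiff_lieDeriv v (contMDiff_lieDeriv v h1)
  have hWc : HasCompactSupport W := hasCompactSupport_lieDeriv v (hasCompactSupport_lieDeriv v h2)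
  have hγc := hγ.continuous
  have sm : ∀ {ψ : G → ℝ} (σ : G), ContMDiff (𝓡 n) 𝓘(ℝ, ℝ) ∞ ψ →
      ContMDiff (𝓡 n) 𝓘(ℝ, ℝ) ∞ fun g => ψ (g * σ) := fun σ h => h.comp contMDiff_mul_right
  have sc : ∀ {ψ : G → ℝ} (σ : G), HasCompactSupport ψ → HasCompactSupport fun g => ψ (g * σ) :=
    fun σ h => h.comp_homeomorph (Homeomorph.mulRight σ)
  -- The translate of `W` is the second derivative of the translated test function, which has the
  -- same `L²` norm as `φ`; so the bound is uniform in `t`.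
  have inner_le : ∀ t : ℝ, |∫ g, W (g * γ (-t)) * f g ∂μ| ≤ K := fun t => by
    have e : ∀ g, W (g * γ (-t)) = lieDeriv v (lieDeriv v fun g => φ (g * γ (-t))) g := fun g => by
      have : (lieDeriv v fun g => φ (g * γ (-t))) = fun g => lieDeriv v φ (g * γ (-t)) :=
        funext fun g => lieDeriv_comp_mul_right hγ h0 h1 (-t) g
      rw [this, lieDeriv_comp_mul_right hγ h0 (contMDiff_lieDeriv v h1)]
    simp_rw [e]
    refine (abs_integral_lieDeriv_lieDeriv_mul_le hf c (sm (γ (-t)) h1) (sc (γ (-t)) h2)).trans ?_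
    rw [eLpNorm_comp_mul_right (n := n) h1.continuous.aestronglyMeasurable]
  have hint : ∀ t : ℝ, Integrable (fun g => W (g * γ (-t)) * f g) μ := fun t =>
    (memLp_of_smooth (sm (γ (-t)) hWs) (sc (γ (-t)) hWc)).integrable_mul (Lp.memLp f)
  have hmeas : AEStronglyMeasurable (fun p : G × ℝ => (1 - p.2) * W (p.1 * γ (-p.2)) * f p.1)
      (μ.prod (volume.restrict (Set.Ioc (0 : ℝ) 1))) := by
    have hWcont := hWs.continuous
    refine AEStronglyMeasurable.mul (Continuous.aestronglyMeasurable (by fun_prop)) ?_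
    exact (Lp.aestronglyMeasurable f).comp_fst
  -- A bound independent of `t`, by Cauchy–Schwarz and right invariance; it supplies the
  -- integrability on the product needed for Fubini.
  have hnorm : ∀ t ∈ Set.Ioc (0 : ℝ) 1, ∫ g, ‖(1 - t) * W (g * γ (-t)) * f g‖ ∂μ ≤
      (eLpNorm W 2 μ).toReal * ‖f‖ := fun t ht => by
    have hWm := memLp_of_smooth (μ := μ) (sm (γ (-t)) hWs) (sc (γ (-t)) hWc)
    have h3 := abs_integral_mul_le hWm.norm ((Lp.memLp f).norm.toLp _)
    rw [eLpNorm_norm, Lp.norm_toLp, eLpNorm_norm, ← Lp.norm_def,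
      eLpNorm_comp_mul_right (n := n) hWs.continuous.aestronglyMeasurable] at h3
    refine le_trans ?_ ((le_abs_self _).trans h3)
    have e : ∫ g, ‖W (g * γ (-t))‖ * ((Lp.memLp f).norm.toLp _ : Lp ℝ 2 μ) g ∂μ =
        ∫ g, ‖W (g * γ (-t)) * f g‖ ∂μ := by
      refine integral_congr_ae ?_
      filter_upwards [(Lp.memLp f).norm.coeFn_toLp] with g hg
      rw [hg, norm_mul]
    rw [e]
    refine integral_mono_of_nonneg (ae_of_all _ fun _ => norm_nonneg _) (hint t).norm
      (ae_of_all _ fun g => ?_)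
    simp only [mul_assoc]
    rw [norm_mul]
    refine mul_le_of_le_one_left (norm_nonneg _) ?_
    rw [Real.norm_eq_abs, abs_le]
    constructor <;> linarith [ht.1, ht.2]
  have hprod : Integrable (fun p : G × ℝ => (1 - p.2) * W (p.1 * γ (-p.2)) * f p.1)
      (μ.prod (volume.restrict (Set.Ioc (0 : ℝ) 1))) := by
    rw [integrable_prod_iff' hmeas]
    constructor
    · refine ae_of_all _ fun t => ?_
      simpa only [mul_assoc] using (hint t).const_mul (1 - t)
    · refine Integrable.of_bound (C := (eLpNorm W 2 μ).toReal * ‖f‖)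
        hmeas.norm.prod_swap.integral_prod_right' ?_
      filter_upwards [ae_restrict_mem measurableSet_Ioc] with t ht
      rw [Real.norm_of_nonneg (integral_nonneg fun _ => norm_nonneg _)]
      exact hnorm t ht
  have swap : ∫ g, (φ (g * γ (-1)) - φ g + lieDeriv v φ g) * f g ∂μ =
      ∫ t in Set.Ioc (0 : ℝ) 1, ∫ g, (1 - t) * W (g * γ (-t)) * f g ∂μ := by
    rw [← integral_integral_swap hprod]
    refine integral_congr_ae (ae_of_all _ fun g => ?_)
    simp only
    rw [taylor_along_isMIntegralCurve hγ h0 h1, intervalIntegral.integral_of_le zero_le_one,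
      ← integral_mul_const]
  rw [swap, ← Real.norm_eq_abs]
  have hK : 0 ≤ K := (abs_nonneg _).trans (inner_le 0)
  refine (norm_setIntegral_le_of_norm_le_const (C := K) (by simp) fun t ht => ?_).trans
    (by simp)
  simp only [mul_assoc]
  rw [integral_const_mul, norm_mul]
  refine (mul_le_of_le_one_left (norm_nonneg _) ?_).trans (inner_le t)
  rw [Real.norm_eq_abs, abs_le]
  constructor <;> linarith [ht.1, ht.2]

/-- The second order Taylor estimate in `L²(G)` for `f ∈ H₂(G)` and a translation by
`exp (∑ cᵢ Xᵢ)`. -/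
lemma eLpNorm_taylor_le {f : Lp ℝ 2 μ} (hf : f ∈ sobolevH2 X μ) (c : Fin n → ℝ) {τ : G}
    (hτ : IsExp (∑ i, c i • X i) τ) :
    eLpNorm (fun g => f (g * τ) - f g - ∑ i, c i * l2Deriv μ (X i) f g) 2 μ ≤
      ENNReal.ofReal (n * (∑ i, c i ^ 2) * sobolevNorm X μ f) := by
  have : IsTopologicalGroup G := topologicalGroup_of_lieGroup (𝓡 n) ∞
  obtain ⟨γ, hγ, h0, rfl⟩ := hτ
  have hinv : (γ 1)⁻¹ = γ (-1) := by
    rw [inv_eq_iff_mul_eq_one, mul_eq_of_isMIntegralCurve hγ h0, add_neg_cancel, h0]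
  have m1 : MemLp (fun g => f (g * γ 1)) 2 μ :=
    (Lp.memLp f).comp_measurePreserving (measurePreserving_mul_right μ (γ 1))
  have m2 : ∀ i, MemLp (fun g => c i * l2Deriv μ (X i) f g) 2 μ := fun i =>
    (Lp.memLp (l2Deriv μ (X i) f)).const_mul (c i)
  have m3 : MemLp (fun g => ∑ i, c i * l2Deriv μ (X i) f g) 2 μ := memLp_finsetSum _ fun i _ => m2 i
  have m : MemLp (fun g => f (g * γ 1) - f g - ∑ i, c i * l2Deriv μ (X i) f g) 2 μ :=
    (m1.sub (Lp.memLp f)).sub m3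
  have hN := sobolevNorm_nonneg (X := X) f
  have key : ‖m.toLp _‖ ≤ n * (∑ i, c i ^ 2) * sobolevNorm X μ f := by
    refine norm_le_of_forall_smooth (n := n) (fun φ h1 h2 => ?_) (by positivity)
    refine le_trans (le_of_eq ?_) (abs_integral_taylor_le hf c hγ h0 h1 h2)
    congr 1
    have hφ := memLp_of_smooth (μ := μ) h1 h2
    have hφ' : MemLp (fun g => φ (g * γ (-1))) 2 μ :=
      hφ.comp_measurePreserving (measurePreserving_mul_right μ (γ (-1)))
    have hvφ : MemLp (lieDeriv (∑ i, c i • X i) φ) 2 μ :=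
      memLp_of_smooth (contMDiff_lieDeriv _ h1) (hasCompactSupport_lieDeriv _ h2)
    have i1 : Integrable (fun g => φ g * f (g * γ 1)) μ := hφ.integrable_mul m1
    have i2 : Integrable (fun g => φ g * f g) μ := hφ.integrable_mul (Lp.memLp f)
    have i12 : Integrable (fun g => φ g * f (g * γ 1) - φ g * f g) μ := i1.sub i2
    have i3 : ∀ i, Integrable (fun g => c i * (φ g * l2Deriv μ (X i) f g)) μ := fun i =>
      (hφ.integrable_mul (Lp.memLp _)).const_mul _
    have i4 : Integrable (fun g => φ (g * γ (-1)) * f g) μ := hφ'.integrable_mul (Lp.memLp f)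
    have i42 : Integrable (fun g => φ (g * γ (-1)) * f g - φ g * f g) μ := i4.sub i2
    have i5 : Integrable (fun g => lieDeriv (∑ i, c i • X i) φ g * f g) μ :=
      hvφ.integrable_mul (Lp.memLp f)
    -- Right invariance moves the translation from `f` to the test function, with `γ 1` replaced by
    -- its inverse.
    have e1 : ∫ g, φ g * f (g * γ 1) ∂μ = ∫ g, φ (g * γ (-1)) * f g ∂μ := by
      rw [← integral_mul_right_eq_self _ (γ (-1))]
      simp [mul_assoc, ← hinv]
    calc ∫ g, φ g * m.toLp _ g ∂μ
        = ∫ g, (φ g * f (g * γ 1) - φ g * f g - ∑ i, c i * (φ g * l2Deriv μ (X i) f g)) ∂μ := by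
          refine integral_congr_ae ?_
          filter_upwards [m.coeFn_toLp] with g hg
          rw [hg, mul_sub, mul_sub, Finset.mul_sum]
          congr 1
          exact Finset.sum_congr rfl fun i _ => by ring
      _ = ∫ g, φ (g * γ (-1)) * f g ∂μ - ∫ g, φ g * f g ∂μ +
            ∫ g, lieDeriv (∑ i, c i • X i) φ g * f g ∂μ := by
          rw [integral_sub i12 (integrable_finsetSum _ fun i _ => i3 i),
            integral_sub i1 i2, integral_finsetSum _ fun i _ => i3 i, e1,
            integral_lieDeriv_sum_mul _ c (fun i => (hf.1 i).spec) h1 h2]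
          simp only [integral_const_mul, sub_eq_add_neg]
      _ = _ := by
          rw [← integral_sub i4 i2, ← integral_add i42 i5]
          exact integral_congr_ae (ae_of_all _ fun g => by simp only; ring)
  rw [Lp.norm_toLp] at key
  exact (ENNReal.le_ofReal_iff_toReal_le m.eLpNorm_lt_top.ne (by positivity)).mpr key

/-- Triangle inequality and right invariance. This serves for `τ` away from the identity, where no
smallness is needed and `τ` need not be an exponential. -/
lemma eLpNorm_jump_le {f : Lp ℝ 2 μ} (c : Fin n → ℝ) (τ : G) :
    eLpNorm (fun g => f (g * τ) - f g - ∑ i, c i * l2Deriv μ (X i) f g) 2 μ ≤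
      ENNReal.ofReal ((2 + ∑ i, |c i|) * sobolevNorm X μ f) := by
  have : IsTopologicalGroup G := topologicalGroup_of_lieGroup (𝓡 n) ∞
  have m1 : MemLp (fun g => f (g * τ)) 2 μ :=
    (Lp.memLp f).comp_measurePreserving (measurePreserving_mul_right μ τ)
  set N := sobolevNorm X μ f
  have hN : 0 ≤ N := sobolevNorm_nonneg f
  let F : Lp ℝ 2 μ := m1.toLp _ - f - ∑ i, c i • l2Deriv μ (X i) f
  have e : (fun g => f (g * τ) - f g - ∑ i, c i * l2Deriv μ (X i) f g) =ᵐ[μ] F := by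
    have h3 : (∑ i, c i • l2Deriv μ (X i) f : Lp ℝ 2 μ) =ᵐ[μ]
        fun g => ∑ i, c i * l2Deriv μ (X i) f g := by
      refine (Lp.coeFn_fun_finsetSum _ _).trans ?_
      filter_upwards [eventually_all.mpr fun i => Lp.coeFn_smul (c i) (l2Deriv μ (X i) f)] with g hg
      exact Finset.sum_congr rfl fun i _ => by simp [hg i]
    filter_upwards [Lp.coeFn_sub (m1.toLp _ - f) (∑ i, c i • l2Deriv μ (X i) f),
      Lp.coeFn_sub (m1.toLp _) f, m1.coeFn_toLp, h3] with g a1 a2 a3 a4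
    simp only [F]
    rw [a1, Pi.sub_apply, a2, Pi.sub_apply, a3, a4]
  rw [eLpNorm_congr_ae e]
  refine (ENNReal.le_ofReal_iff_toReal_le (Lp.eLpNorm_ne_top F) (by positivity)).mpr ?_
  rw [← Lp.norm_def]
  have n1 : ‖m1.toLp _‖ ≤ N := by
    rw [Lp.norm_toLp, eLpNorm_comp_mul_right (n := n) (Lp.aestronglyMeasurable f), ← Lp.norm_def]
    exact norm_le_sobolevNorm f
  calc ‖F‖ ≤ ‖m1.toLp _‖ + ‖f‖ + ∑ i, ‖c i • l2Deriv μ (X i) f‖ :=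
        (norm_sub_le _ _).trans (add_le_add (norm_sub_le _ _) (norm_sum_le _ _))
    _ ≤ N + N + ∑ i, |c i| * N := by
        gcongr with i
        · exact norm_le_sobolevNorm f
        · rw [norm_smul, Real.norm_eq_abs]
          gcongr
          exact norm_l2Deriv_le_sobolevNorm f i
    _ = _ := by rw [← Finset.sum_mul]; ring

end WeakTaylorTranslate

/-! ### Dominated kernels and Minkowski's inequality. -/

section MeasureTheoretic

open ProbabilityTheory ENNReal

variable {α β : Type*} [MeasurableSpace α] [MeasurableSpace β]

/-- By Markov's inequality the sets `{w ≥ 1/(m+1)}` have finite measure; with the null set `{w = 0}`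
they cover the space. -/
lemma sigmaFinite_of_lintegral_lt_top {κ : Measure β} {w : β → ℝ≥0∞} (hw : Measurable w)
    (hfin : ∫⁻ τ, w τ ∂κ < ⊤) (hpos : ∀ᵐ τ ∂κ, w τ ≠ 0) : SigmaFinite κ := by
  refine Measure.sigmaFinite_of_countable
    (S := insert {τ | w τ = 0} (Set.range fun m : ℕ => {τ | ((m : ℝ≥0∞) + 1)⁻¹ ≤ w τ}))
    ((Set.countable_range _).insert _) ?_ ?_
  · rintro s (rfl | ⟨m, rfl⟩)
    · have : κ {τ | w τ = 0} = 0 := by simpa [ae_iff] using hpos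
      simp [this]
    · refine (meas_ge_le_lintegral_div hw.aemeasurable ?_ ?_).trans_lt
        (ENNReal.div_lt_top hfin.ne ?_)
      · simp
      · simp
      · simp
  · refine Set.eq_univ_of_forall fun τ => ?_
    by_cases h : w τ = 0
    · exact ⟨_, Set.mem_insert _ _, h⟩
    · obtain ⟨m, hm⟩ := ENNReal.exists_inv_nat_lt h
      refine ⟨_, Set.mem_insert_of_mem _ ⟨m, rfl⟩, le_trans ?_ hm.le⟩
      exact ENNReal.inv_le_inv.mpr le_self_add

/-- Cutting along a disjoint sequence of sets of finite `κ`-measure gives finite kernels, since the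
bound by `κ` is uniform in the parameter. -/
lemma isSFiniteKernel_of_le (k : Kernel α β) (κ : Measure β) [SigmaFinite κ]
    (hk : ∀ a, k a ≤ κ) : IsSFiniteKernel k := by
  have hm := fun m => MeasurableSet.disjointed (measurableSet_spanningSets κ) m
  have e : k = Kernel.sum fun m => k.restrict (hm m) := by
    ext1 a
    rw [Kernel.sum_apply]
    simp only [Kernel.restrict_apply]
    rw [← Measure.restrict_iUnion (disjoint_disjointed _) hm, iUnion_disjointed,
      iUnion_spanningSets, Measure.restrict_univ]
  have : ∀ m, IsFiniteKernel (k.restrict (hm m)) := fun m => by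
    refine ⟨κ (spanningSets κ m), measure_spanningSets_lt_top κ m, fun a => ?_⟩
    rw [Kernel.restrict_apply, Measure.restrict_apply_univ]
    exact (hk a _).trans (measure_mono (disjointed_subset _ _))
  rw [e]
  exact Kernel.isSFiniteKernel_sum

/-- Cauchy–Schwarz for the splitting `F = (F w^{-1/2}) · w^{1/2}`, valid where `w` is neither `0`
nor infinite. -/
lemma sq_lintegral_le {κ : Measure β} {F w : β → ℝ≥0∞} (hF : Measurable F) (hw : Measurable w)
    (h0 : ∀ᵐ τ ∂κ, w τ ≠ 0) (ht : ∀ τ, w τ ≠ ⊤) :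
    (∫⁻ τ, F τ ∂κ) ^ 2 ≤ (∫⁻ τ, F τ ^ 2 * (w τ)⁻¹ ∂κ) * ∫⁻ τ, w τ ∂κ := by
  have H := ENNReal.lintegral_mul_le_Lp_mul_Lq κ Real.HolderConjugate.two_two
    (f := fun τ => F τ * w τ ^ (-(1 / 2) : ℝ)) (g := fun τ => w τ ^ (1 / 2 : ℝ))
    (hF.mul (hw.pow_const _)).aemeasurable (hw.pow_const _).aemeasurable
  have e1 : ∫⁻ τ, F τ ∂κ =
      ∫⁻ τ, ((fun τ => F τ * w τ ^ (-(1 / 2) : ℝ)) * fun τ => w τ ^ (1 / 2 : ℝ)) τ ∂κ := by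
    refine lintegral_congr_ae ?_
    filter_upwards [h0] with τ hτ
    simp only [Pi.mul_apply]
    rw [mul_assoc, ← ENNReal.rpow_add _ _ hτ (ht τ)]
    simp
  have e2 : ∀ τ, (F τ * w τ ^ (-(1 / 2) : ℝ)) ^ (2 : ℝ) = F τ ^ 2 * (w τ)⁻¹ := fun τ => by
    rw [ENNReal.mul_rpow_of_nonneg _ _ (by norm_num), ← ENNReal.rpow_mul, ENNReal.rpow_two]
    norm_num [ENNReal.rpow_neg_one]
  have e3 : ∀ τ, (w τ ^ (1 / 2 : ℝ)) ^ (2 : ℝ) = w τ := fun τ => by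
    rw [← ENNReal.rpow_mul]; norm_num
  simp_rw [e2, e3] at H
  rw [e1]
  refine (pow_le_pow_left' H 2).trans (le_of_eq ?_)
  rw [mul_pow, ← ENNReal.rpow_two, ← ENNReal.rpow_two, ← ENNReal.rpow_mul, ← ENNReal.rpow_mul]
  norm_num

/-- A form of Minkowski's integral inequality. -/
lemma lintegral_sq_lintegral_le {μ : Measure α} [SFinite μ] {κ : Measure β} [SFinite κ]
    {F : α × β → ℝ≥0∞} (hF : Measurable F) {w : β → ℝ≥0∞} (hw : Measurable w)
    (h0 : ∀ᵐ τ ∂κ, w τ ≠ 0) (ht : ∀ τ, w τ ≠ ⊤) {A : ℝ≥0∞}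
    (hA : ∀ τ, ∫⁻ g, F (g, τ) ^ 2 ∂μ ≤ A * w τ ^ 2) :
    ∫⁻ g, (∫⁻ τ, F (g, τ) ∂κ) ^ 2 ∂μ ≤ A * (∫⁻ τ, w τ ∂κ) ^ 2 := by
  have hm : Measurable fun p : α × β => F p ^ 2 * (w p.2)⁻¹ :=
    (hF.pow_const 2).mul (hw.comp measurable_snd).inv
  calc ∫⁻ g, (∫⁻ τ, F (g, τ) ∂κ) ^ 2 ∂μ
      ≤ ∫⁻ g, (∫⁻ τ, F (g, τ) ^ 2 * (w τ)⁻¹ ∂κ) * ∫⁻ τ, w τ ∂κ ∂μ :=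
        -- The weight in Cauchy–Schwarz is the one that bounds the slices: after Tonelli, `A w² ·
        -- w⁻¹ = A w` is left, so no constant is lost.
        lintegral_mono fun g => sq_lintegral_le (hF.comp measurable_prodMk_left) hw h0 ht
    _ = (∫⁻ τ, ∫⁻ g, F (g, τ) ^ 2 * (w τ)⁻¹ ∂μ ∂κ) * ∫⁻ τ, w τ ∂κ := by
        rw [lintegral_mul_const _ hm.lintegral_prod_right',
          lintegral_lintegral_swap hm.aemeasurable]
    _ ≤ (∫⁻ τ, A * w τ ∂κ) * ∫⁻ τ, w τ ∂κ := by
        refine mul_le_mul_left (lintegral_mono_ae ?_) _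
        filter_upwards [h0] with τ hτ
        have hF' : Measurable fun g => F (g, τ) ^ 2 :=
          (hF.comp measurable_prodMk_right).pow_const 2
        rw [lintegral_mul_const _ hF']
        refine (mul_le_mul_left (hA τ) _).trans (le_of_eq ?_)
        rw [sq, mul_assoc, mul_assoc, ENNReal.mul_inv_cancel hτ (ht τ), mul_one]
    _ = A * (∫⁻ τ, w τ ∂κ) ^ 2 := by
        rw [lintegral_const_mul _ hw]
        ring

lemma exists_lp_bounded_mul {μ : Measure α} {m : α → ℝ} (hm : Measurable m) {M : ℝ}
    (hM : ∀ g, |m g| ≤ M) (u : Lp ℝ 2 μ) :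
    ∃ h : Lp ℝ 2 μ, (h =ᵐ[μ] fun g => m g * u g) ∧ ‖h‖ ≤ M * ‖u‖ := by
  have hb : ∀ᵐ g ∂μ, ‖m g * u g‖ ≤ M * ‖u g‖ := ae_of_all _ fun g => by
    rw [norm_mul]
    exact mul_le_mul_of_nonneg_right (hM g) (norm_nonneg _)
  have hL : MemLp (fun g => m g * u g) 2 μ :=
    (Lp.memLp u).of_le_mul (hm.aestronglyMeasurable.mul (Lp.aestronglyMeasurable u)) hb
  refine ⟨hL.toLp _, hL.coeFn_toLp, Lp.norm_le_mul_norm_of_ae_le_mul ?_⟩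
  filter_upwards [hL.coeFn_toLp, hb] with g h1 h2
  rwa [h1]

end MeasureTheoretic

/-! ### The weight and a common majorant of the Lévy kernel. -/

namespace Characteristics

open ProbabilityTheory ENNReal

variable {n : ℕ} {G : Type*} [TopologicalSpace G] [ChartedSpace (EuclideanSpace ℝ (Fin n)) G]
  [Group G] [MeasurableSpace G]
  [T2Space G] [SecondCountableTopology G] [LieGroup (𝓡 n) ∞ G] [BorelSpace G]
  {X : Module.Basis (Fin n) ℝ (GroupLieAlgebra (𝓡 n) G)} (S : Characteristics X)

open Classical in
/-- The function `∑ xᵢ²` on `U`, extended by `1`. -/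
noncomputable def weight (τ : G) : ℝ≥0∞ := if τ ∈ S.U then ENNReal.ofReal (∑ i, S.x i τ ^ 2) else 1

lemma continuous_x (i : Fin n) : Continuous (S.x i) := (S.canonical.contMDiff i).continuous

lemma measurable_weight : Measurable S.weight := by
  have := S.continuous_x
  exact Measurable.ite S.canonical.isOpen.measurableSet
    (ENNReal.continuous_ofReal.comp (by fun_prop)).measurable measurable_const

lemma weight_ne_top (τ : G) : S.weight τ ≠ ⊤ := by
  unfold weight; split_ifs <;> simp

/-- Off `U` the weight is `1`; on `U` all coordinates vanish, so `τ = exp 0`. -/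
lemma eq_one_of_weight_eq_zero {τ : G} (h : S.weight τ = 0) : τ = 1 := by
  unfold weight at h
  split_ifs at h with hU
  · have h1 : ∑ i, S.x i τ ^ 2 = 0 :=
      le_antisymm (ENNReal.ofReal_eq_zero.mp h) (Finset.sum_nonneg fun _ _ => sq_nonneg _)
    rw [Finset.sum_eq_zero_iff_of_nonneg fun _ _ => sq_nonneg _] at h1
    have h2 : ∀ i, S.x i τ = 0 := fun i =>
      (pow_eq_zero_iff two_ne_zero).mp (h1 i (Finset.mem_univ i))
    have h3 := S.canonical.isExp τ hU
    simp only [h2, zero_smul, Finset.sum_const_zero] at h3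
    exact h3.eq_one_of_zero
  · exact absurd h one_ne_zero

lemma exists_bound_x : ∃ B : ℝ, 0 ≤ B ∧ ∀ i τ, |S.x i τ| ≤ B := by
  choose B hB using fun i =>
    (S.canonical.hasCompactSupport i).exists_bound_of_continuous (S.continuous_x i)
  have hB0 : ∀ i, 0 ≤ B i := fun i => (norm_nonneg _).trans (hB i 1)
  exact ⟨∑ i, B i, Finset.sum_nonneg fun i _ => hB0 i, fun i τ => (hB i τ).trans
    (Finset.single_le_sum (fun i _ => hB0 i) (Finset.mem_univ i))⟩

/-- The kernel `g ↦ ν(g, g dτ)`. -/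
noncomputable def shiftedKernel : Kernel G G where
  toFun g := leftShift g (S.ν g)
  measurable' := Measure.measurable_of_measurable_coe _ S.kernel.measurable

lemma shiftedKernel_apply (g : G) : S.shiftedKernel g = leftShift g (S.ν g) := rfl

include S in
-- The weight on `U` is not truncated, whereas the Lévy condition controls the truncated square;
-- boundedness of the coordinates bridges the two.
lemma exists_le_mul_truncSq : ∃ B : ℝ≥0∞, B ≠ ⊤ ∧
    ∀ τ, ENNReal.ofReal (∑ i, S.x i τ ^ 2) ≤ B * truncSq S.x τ := by
  obtain ⟨B, hB0, hB⟩ := S.exists_bound_x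
  -- The term `n * B ^ 2` covers the case where the truncation is active, the `1` the other case.
  refine ⟨ENNReal.ofReal (n * B ^ 2 + 1), ENNReal.ofReal_ne_top, fun τ => ?_⟩
  have hq : ∑ i, S.x i τ ^ 2 ≤ n * B ^ 2 := by
    refine (Finset.sum_le_card_nsmul _ _ (B ^ 2) fun i _ => ?_).trans (by simp)
    exact sq_le_sq' (abs_le.mp (hB i τ)).1 (abs_le.mp (hB i τ)).2
  have hq0 : 0 ≤ ∑ i, S.x i τ ^ 2 := Finset.sum_nonneg fun _ _ => sq_nonneg _
  rw [truncSq, ← ENNReal.ofReal_mul (by positivity)]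
  refine ENNReal.ofReal_le_ofReal ?_
  rcases le_total (∑ i, S.x i τ ^ 2) 1 with h | h
  · rw [min_eq_left h]
    exact le_mul_of_one_le_left hq0 (by linarith [hq0.trans hq])
  · rw [min_eq_right h]
    linarith

/-- The measures `ν(g, g dτ)` have a common majorant that integrates the weight. -/
lemma exists_dominating : ∃ κ : Measure G, (∀ g, S.shiftedKernel g ≤ κ) ∧
    ∫⁻ τ, S.weight τ ∂κ < ⊤ ∧ ∀ᵐ τ ∂κ, S.weight τ ≠ 0 := by
  have : IsTopologicalGroup G := topologicalGroup_of_lieGroup (𝓡 n) ∞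
  obtain ⟨g', hg'⟩ := S.dens_on
  have hU := S.canonical.isOpen.measurableSet
  set M := ⨆ τ ∈ S.Uᶜ, ⨆ g, S.dens g τ with hM
  -- On `U` the density at `g'` is the largest one, so that member of the family dominates the rest;
  -- off `U` all densities are at most `M`.
  refine ⟨(S.shiftedKernel g').restrict S.U + M • S.ρ.restrict S.Uᶜ, fun g => ?_, ?_, ?_⟩
  · refine Measure.le_iff.mpr fun E hE => ?_
    rw [← measure_inter_add_sdiff E hU, Set.sdiff_eq]
    simp only [Measure.coe_add, Measure.coe_smul, Pi.add_apply, Pi.smul_apply, smul_eq_mul,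
      Measure.restrict_apply hE, shiftedKernel_apply, S.leftShift_eq]
    rw [withDensity_apply _ (hE.inter hU), withDensity_apply _ (hE.inter hU),
      withDensity_apply _ (hE.inter hU.compl)]
    refine add_le_add (setLIntegral_mono (S.measurable_dens g') fun τ hτ => ?_) ?_
    · rw [hg' τ hτ.2]
      exact le_iSup (fun g => S.dens g τ) g
    · rw [← setLIntegral_const]
      refine setLIntegral_mono measurable_const fun τ hτ => ?_
      exact (le_iSup (fun g => S.dens g τ) g).trans (le_iSup₂_of_le τ hτ.2 le_rfl)
  · rw [lintegral_add_measure, lintegral_smul_measure]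
    refine ENNReal.add_lt_top.mpr ⟨?_, ENNReal.mul_lt_top S.dens_off ?_⟩
    · obtain ⟨B, hBt, hB⟩ := S.exists_le_mul_truncSq
      calc ∫⁻ τ in S.U, S.weight τ ∂(S.shiftedKernel g')
          ≤ ∫⁻ τ in S.U, B * truncSq S.x τ ∂(S.shiftedKernel g') := by
            refine setLIntegral_mono' hU fun τ hτ => ?_
            rw [weight, if_pos hτ]
            exact hB τ
        _ ≤ ∫⁻ τ, B * truncSq S.x τ ∂(S.shiftedKernel g') := setLIntegral_le_lintegral _ _
        _ = B * ∫⁻ τ, truncSq S.x τ ∂(S.shiftedKernel g') := lintegral_const_mul' _ _ hBt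
        _ < ⊤ := ENNReal.mul_lt_top hBt.lt_top ((le_iSup
            (fun g => ∫⁻ τ, truncSq S.x τ ∂(leftShift g (S.ν g))) g').trans_lt S.kernel.iSup_lt_top)
    · have e : ∫⁻ τ in S.Uᶜ, S.weight τ ∂S.ρ = ∫⁻ τ in S.Uᶜ, 1 ∂S.ρ :=
        setLIntegral_congr_fun hU.compl fun τ hτ => by rw [weight, if_neg hτ]
      rw [e, setLIntegral_one]
      exact S.levy.compl_lt_top _ (S.canonical.isOpen.mem_nhds S.canonical.one_mem)
  -- The weight can vanish only at the identity, which neither part of the majorant charges.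
  · rw [ae_iff]
    refine measure_mono_null (t := {1}) (fun τ hτ => ?_) ?_
    · exact S.eq_one_of_weight_eq_zero (not_not.mp hτ)
    · have h1 : S.shiftedKernel g' {1} = 0 := by
        rw [shiftedKernel_apply, leftShift, Measure.map_apply (measurable_const_mul _)
          (measurableSet_singleton 1)]
        refine (congrArg (S.ν g') ?_).trans (S.kernel.singleton_self g')
        ext τ
        simp only [Set.mem_preimage, Set.mem_singleton_iff, inv_mul_eq_one]
        exact eq_comm
      have h2 : (S.shiftedKernel g').restrict S.U {1} = 0 :=
        le_antisymm ((Measure.restrict_apply_le _ _).trans h1.le) zero_le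
      have h3 : S.ρ.restrict S.Uᶜ {1} = 0 :=
        le_antisymm ((Measure.restrict_apply_le _ _).trans S.levy.singleton_one.le) zero_le
      simp [h2, h3]

end Characteristics

/-! ### Boundedness of the operator terms. -/

namespace Characteristics

open ProbabilityTheory ENNReal

variable {n : ℕ} {G : Type*} [TopologicalSpace G] [ChartedSpace (EuclideanSpace ℝ (Fin n)) G]
  [Group G] [MeasurableSpace G]
  [T2Space G] [SecondCountableTopology G] [LieGroup (𝓡 n) ∞ G] [BorelSpace G]
  {X : Module.Basis (Fin n) ℝ (GroupLieAlgebra (𝓡 n) G)} (S : Characteristics X)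

lemma measurable_jump_mul {f : G → ℝ} {D : Fin n → G → ℝ} (hf : Measurable f)
    (hD : ∀ i, Measurable (D i)) : Measurable fun p : G × G => S.jump f D p.1 (p.1 * p.2) := by
  have : IsTopologicalGroup G := topologicalGroup_of_lieGroup (𝓡 n) ∞
  have hx := fun i => (S.continuous_x i).measurable
  simp only [jump, inv_mul_cancel_left]
  fun_prop

lemma integrable_jump_iff (f : G → ℝ) (D : Fin n → G → ℝ) (g : G) :
    Integrable (S.jump f D g) (S.ν g) ↔
      Integrable (fun τ => S.jump f D g (g * τ)) (S.shiftedKernel g) := by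
  have : IsTopologicalGroup G := topologicalGroup_of_lieGroup (𝓡 n) ∞
  rw [shiftedKernel_apply, leftShift, (measurableEmbedding_mulLeft g⁻¹).integrable_map_iff]
  simp [Function.comp_def]

lemma integral_jump_eq (f : G → ℝ) (D : Fin n → G → ℝ) (g : G) :
    ∫ τ, S.jump f D g τ ∂(S.ν g) = ∫ τ, S.jump f D g (g * τ) ∂(S.shiftedKernel g) := by
  have : IsTopologicalGroup G := topologicalGroup_of_lieGroup (𝓡 n) ∞
  rw [shiftedKernel_apply, leftShift, (measurableEmbedding_mulLeft g⁻¹).integral_map]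
  simp

variable {μ : Measure G} [IsFiniteMeasureOnCompacts μ] [μ.IsMulRightInvariant]

/-- The increments `f(gτ) - f(g) - xⁱ(τ) Xᵢ f(g)` are bounded in `L²(G)` by the weight of `τ`. -/
lemma exists_eLpNorm_jump_le : ∃ K : ℝ, 0 ≤ K ∧ ∀ f ∈ sobolevH2 X μ, ∀ τ : G,
    eLpNorm (fun g => S.jump f (fun i => l2Deriv μ (X i) f) g (g * τ)) 2 μ ≤
      ENNReal.ofReal (K * sobolevNorm X μ f) * S.weight τ := by
  obtain ⟨B, hB0, hB⟩ := S.exists_bound_x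
  -- The Taylor constant `n` is for `τ ∈ U`; `2 + n * B` comes from the triangle inequality off `U`.
  refine ⟨n + (2 + n * B), by positivity, fun f hf τ => ?_⟩
  have hN : 0 ≤ sobolevNorm X μ f := sobolevNorm_nonneg f
  simp only [jump, inv_mul_cancel_left]
  by_cases hU : τ ∈ S.U
  · refine (eLpNorm_taylor_le hf (fun i => S.x i τ) (S.canonical.isExp τ hU)).trans ?_
    have hq0 : 0 ≤ ∑ i, S.x i τ ^ 2 := Finset.sum_nonneg fun _ _ => sq_nonneg _
    rw [weight, if_pos hU, ← ENNReal.ofReal_mul (by positivity)]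
    refine ENNReal.ofReal_le_ofReal ?_
    rw [mul_right_comm]
    gcongr
    have : 0 ≤ n * B := by positivity
    linarith
  · refine (eLpNorm_jump_le (fun i => S.x i τ) τ).trans ?_
    rw [weight, if_neg hU, mul_one]
    refine ENNReal.ofReal_le_ofReal ?_
    have h1 : ∑ i, |S.x i τ| ≤ n * B :=
      (Finset.sum_le_card_nsmul _ _ B fun i _ => hB i τ).trans (by simp)
    have : (0 : ℝ) ≤ n := by positivity
    exact mul_le_mul_of_nonneg_right (by linarith) hN

/-- The integral part of the Courrège–Hunt operator is bounded from `H₂(G)` to `L²(G)`. -/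
lemma exists_integral_part : ∃ C : ℝ, 0 ≤ C ∧ ∀ f ∈ sobolevH2 X μ,
    (∀ᵐ g ∂μ, Integrable (S.jump f (fun i => l2Deriv μ (X i) f) g) (S.ν g)) ∧
    ∃ h : Lp ℝ 2 μ,
      (h =ᵐ[μ] fun g => ∫ τ, S.jump f (fun i => l2Deriv μ (X i) f) g τ ∂(S.ν g)) ∧
      ‖h‖ ≤ C * sobolevNorm X μ f := by
  have : IsTopologicalGroup G := topologicalGroup_of_lieGroup (𝓡 n) ∞
  have := locallyCompactSpace_of_lieGroup (n := n) (G := G)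
  obtain ⟨κ, hκ, hW, hpos⟩ := S.exists_dominating
  obtain ⟨K, hK, hKf⟩ := S.exists_eLpNorm_jump_le (μ := μ)
  have := sigmaFinite_of_lintegral_lt_top S.measurable_weight hW hpos
  have := isSFiniteKernel_of_le S.shiftedKernel κ hκ
  set W := ∫⁻ τ, S.weight τ ∂κ
  refine ⟨K * W.toReal, by positivity, fun f hf => ?_⟩
  set N := sobolevNorm X μ f with hNdef
  have hN : 0 ≤ N := sobolevNorm_nonneg f
  let J : G × G → ℝ := fun p => S.jump f (fun i => l2Deriv μ (X i) f) p.1 (p.1 * p.2)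
  have hJ : Measurable J := S.measurable_jump_mul (Lp.stronglyMeasurable f).measurable
    fun i => (Lp.stronglyMeasurable (l2Deriv μ (X i) f)).measurable
  -- Working with squares turns the slice bounds into the form of the Minkowski inequality.
  have eR : ∀ u : G → ℝ, eLpNorm u 2 μ ^ 2 = ∫⁻ g, ‖u g‖ₑ ^ 2 ∂μ := fun u => by
    simpa using eLpNorm_nnreal_pow_eq_lintegral (μ := μ) (f := u) (p := 2) two_ne_zero
  have key : ∫⁻ g, (∫⁻ τ, ‖J (g, τ)‖ₑ ∂κ) ^ 2 ∂μ ≤ ENNReal.ofReal (K * N) ^ 2 * W ^ 2 := by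
    refine lintegral_sq_lintegral_le (F := fun p => ‖J p‖ₑ) hJ.enorm S.measurable_weight hpos
      S.weight_ne_top fun τ => ?_
    rw [← eR, ← mul_pow]
    exact pow_le_pow_left' (hKf f hf τ) 2
  have hmeas : Measurable fun g => ∫⁻ τ, ‖J (g, τ)‖ₑ ∂κ := hJ.enorm.lintegral_prod_right'
  have hint : ∀ᵐ g ∂μ, Integrable (fun τ => J (g, τ)) (S.shiftedKernel g) := by
    have h1 : ∫⁻ g, (∫⁻ τ, ‖J (g, τ)‖ₑ ∂κ) ^ 2 ∂μ ≠ ⊤ :=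
      (key.trans_lt (ENNReal.mul_lt_top (ENNReal.pow_lt_top ENNReal.ofReal_lt_top)
        (ENNReal.pow_lt_top hW))).ne
    filter_upwards [ae_lt_top (hmeas.pow_const 2) h1] with g hg
    have h2 : ∫⁻ τ, ‖J (g, τ)‖ₑ ∂κ < ⊤ := by simpa using hg
    have h3 : Integrable (fun τ => J (g, τ)) κ :=
      ⟨(hJ.comp measurable_prodMk_left).aestronglyMeasurable, h2⟩
    exact h3.mono_measure (hκ g)
  -- Domination by `κ` controls sizes only; measurability in `g` rests on the s-finite kernel
  -- structure.
  have hsm : StronglyMeasurable fun g => ∫ τ, J (g, τ) ∂(S.shiftedKernel g) :=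
    hJ.stronglyMeasurable.integral_kernel_prod_right'
  have hnorm : eLpNorm (fun g => ∫ τ, J (g, τ) ∂(S.shiftedKernel g)) 2 μ ≤
      ENNReal.ofReal (K * N) * W := by
    refine (ENNReal.pow_le_pow_left_iff two_ne_zero).mp ?_
    rw [eR, mul_pow]
    refine (lintegral_mono fun g => pow_le_pow_left' ?_ 2).trans key
    exact (enorm_integral_le_lintegral_enorm _).trans (lintegral_mono' (hκ g) le_rfl)
  have hfin : ENNReal.ofReal (K * N) * W < ⊤ := ENNReal.mul_lt_top ENNReal.ofReal_lt_top hW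
  have hL : MemLp (fun g => ∫ τ, J (g, τ) ∂(S.shiftedKernel g)) 2 μ :=
    ⟨hsm.aestronglyMeasurable, hnorm.trans_lt hfin⟩
  refine ⟨?_, hL.toLp _, ?_, ?_⟩
  · filter_upwards [hint] with g hg
    exact (S.integrable_jump_iff _ _ g).mpr hg
  · filter_upwards [hL.coeFn_toLp] with g hg
    rw [hg, S.integral_jump_eq]
  · rw [Lp.norm_toLp]
    refine (ENNReal.toReal_mono hfin.ne hnorm).trans (le_of_eq ?_)
    rw [ENNReal.toReal_mul, ENNReal.toReal_ofReal (by positivity)]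
    ring

/-- Every `f ∈ H₂(G)` is in the domain of the Courrège–Hunt operator, with a bound. -/
lemma exists_isValue : ∃ C : ℝ, 0 < C ∧ ∀ f ∈ sobolevH2 X μ,
    ∃ h : Lp ℝ 2 μ, S.IsValue μ f h ∧ ‖h‖ ≤ C * sobolevNorm X μ f := by
  obtain ⟨C, hC, hCf⟩ := S.exists_integral_part (μ := μ)
  choose Mb hMb using S.bounded_b
  choose Ma hMa using S.bounded_a
  have hMb0 : ∀ i, 0 ≤ Mb i := fun i => (abs_nonneg _).trans (hMb i 1)
  have hMa0 : ∀ i j, 0 ≤ Ma i j := fun i j => (abs_nonneg _).trans (hMa i j 1)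
  have p1 : 0 ≤ ∑ i, Mb i := Finset.sum_nonneg fun i _ => hMb0 i
  have p2 : 0 ≤ ∑ i, ∑ j, Ma i j :=
    Finset.sum_nonneg fun i _ => Finset.sum_nonneg fun j _ => hMa0 i j
  -- The summand `1` only makes the constant strictly positive.
  refine ⟨∑ i, Mb i + ∑ i, ∑ j, Ma i j + C + 1, by positivity, fun f hf => ?_⟩
  set N := sobolevNorm X μ f
  have hN : 0 ≤ N := sobolevNorm_nonneg f
  obtain ⟨hint, h3, h3e, h3n⟩ := hCf f hf
  choose h1 h1e h1n using fun i =>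
    exists_lp_bounded_mul (S.measurable_b i) (hMb i) (l2Deriv μ (X i) f)
  choose h2 h2e h2n using fun i j =>
    exists_lp_bounded_mul (S.measurable_a i j) (hMa i j) (l2Deriv μ (X i) (l2Deriv μ (X j) f))
  refine ⟨∑ i, h1 i + ∑ i, ∑ j, h2 i j + h3, ⟨fun i => l2Deriv μ (X i) f,
    fun i j => l2Deriv μ (X i) (l2Deriv μ (X j) f), fun i => (hf.1 i).spec,
    fun i j => (hf.2 i j).spec, hint, ?_⟩, ?_⟩
  · have e1 : (∑ i, h1 i : Lp ℝ 2 μ) =ᵐ[μ] fun g => ∑ i, h1 i g := Lp.coeFn_fun_finsetSum _ _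
    have e2 : (∑ i, ∑ j, h2 i j : Lp ℝ 2 μ) =ᵐ[μ] fun g => ∑ i, (∑ j, h2 i j : Lp ℝ 2 μ) g :=
      Lp.coeFn_fun_finsetSum _ _
    have e3 : ∀ i, (∑ j, h2 i j : Lp ℝ 2 μ) =ᵐ[μ] fun g => ∑ j, h2 i j g := fun i =>
      Lp.coeFn_fun_finsetSum _ _
    filter_upwards [Lp.coeFn_add (∑ i, h1 i + ∑ i, ∑ j, h2 i j) h3,
      Lp.coeFn_add (∑ i, h1 i) (∑ i, ∑ j, h2 i j), e1, e2, eventually_all.mpr e3, h3e,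
      eventually_all.mpr h1e, eventually_all.mpr fun i => eventually_all.mpr (h2e i)]
      with g a1 a2 a3 a4 a5 a6 a7 a8
    rw [a1, Pi.add_apply, a2, Pi.add_apply, a3, a4, a6, formula]
    simp only [a5, a7, a8]
  · calc ‖∑ i, h1 i + ∑ i, ∑ j, h2 i j + h3‖
        ≤ ∑ i, ‖h1 i‖ + ∑ i, ∑ j, ‖h2 i j‖ + ‖h3‖ := by
          refine (norm_add_le _ _).trans (add_le_add_left ((norm_add_le _ _).trans ?_) _)
          refine add_le_add (norm_sum_le _ _) ((norm_sum_le _ _).trans ?_)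
          exact Finset.sum_le_sum fun i _ => norm_sum_le _ _
      _ ≤ ∑ i, Mb i * N + ∑ i, ∑ j, Ma i j * N + C * N := by
          refine add_le_add (add_le_add (Finset.sum_le_sum fun i _ => ?_)
            (Finset.sum_le_sum fun i _ => Finset.sum_le_sum fun j _ => ?_)) h3n
          · exact (h1n i).trans
              (mul_le_mul_of_nonneg_left (norm_l2Deriv_le_sobolevNorm f i) (hMb0 i))
          · exact (h2n i j).trans
              (mul_le_mul_of_nonneg_left (norm_l2Deriv_l2Deriv_le_sobolevNorm f i j) (hMa0 i j))
      _ = (∑ i, Mb i + ∑ i, ∑ j, Ma i j + C) * N := by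
          simp only [add_mul, Finset.sum_mul]
      _ ≤ _ := by
          exact mul_le_mul_of_nonneg_right (by linarith) hN

variable {S} in
lemma IsValue.unique {f h h' : Lp ℝ 2 μ} (H : S.IsValue μ f h) (H' : S.IsValue μ f h') :
    h = h' := by
  have K := H.add (H'.smul (-1))
  rw [neg_one_smul, neg_one_smul, add_neg_cancel] at K
  simpa [add_neg_eq_zero] using K.eq_zero

end Characteristics

end CourregeHunt

/-! ### The theorem. -/

open CourregeHunt in
theorem mainTheorem5 {n : ℕ} {G : Type*} [TopologicalSpace G] [T2Space G]
    [SecondCountableTopology G] [ChartedSpace (EuclideanSpace ℝ (Fin n)) G] [Group G]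
    [LieGroup (𝓡 n) ∞ G] [MeasurableSpace G] [BorelSpace G]
    (μ : Measure G) [IsFiniteMeasureOnCompacts μ] [μ.IsMulRightInvariant] [μ.IsOpenPosMeasure]
    (X : Module.Basis (Fin n) ℝ (GroupLieAlgebra (𝓡 n) G)) (S : Characteristics X) :
    ∃ hdom : sobolevH2 X μ ≤ (S.op μ).domain,
      (∃ C : ℝ, 0 < C ∧ ∀ f : sobolevH2 X μ,
        ‖S.op μ ⟨f, hdom f.2⟩‖ ≤ C * sobolevNorm X μ f) ∧
      ∃ T : SobolevSpace X μ →L[ℝ] Lp ℝ 2 μ,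
        ∀ f : SobolevSpace X μ, T f = S.op μ ⟨f.1, hdom f.2⟩ := by
  obtain ⟨C, hC, H⟩ := S.exists_isValue (μ := μ)
  have hdom : sobolevH2 X μ ≤ (S.op μ).domain := fun f hf => by
    obtain ⟨h, hh, -⟩ := H f hf
    exact (S.mem_op_domain μ).mpr ⟨h, hh⟩
  have hbound : ∀ f : sobolevH2 X μ, ‖S.op μ ⟨f, hdom f.2⟩‖ ≤ C * sobolevNorm X μ f := fun f => by
    obtain ⟨h, hh, hn⟩ := H f f.2
    -- The operator is obtained abstractly from its graph; uniqueness of values identifies its value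
    -- with the function that was estimated.
    rwa [(S.isValue_op μ ⟨f, hdom f.2⟩).unique hh]
  refine ⟨hdom, ⟨C, hC, hbound⟩, ?_⟩
  let L : SobolevSpace X μ →ₗ[ℝ] Lp ℝ 2 μ := (S.op μ).toFun ∘ₗ Submodule.inclusion hdom
  refine ⟨L.mkContinuous C fun f => ?_, fun f => rfl⟩
  rw [SobolevSpace.norm_eq]
  exact hbound f
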